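/- Let $z_0\in(0,1)$, $K>0$, $0<\varepsilon<1$ and $0<\beta_*\le\beta^*\le 1$. For $n\ge 1$ one observes $y_1,\dots,y_n$, where $$y_0=0,\qquad y_k=S(k/n)\,y_{k-1}+\xi_k,\quad 1\le k\le n,$$ with $\xi_1,\dots,\xi_n$ independent standard Gaussian variables; $\mathbf P_S$ is the law of $(y_1,\dots,y_n)$ and $\mathbf E_S$ the expectation under it. For $\beta\in[\beta_*,\beta^*]$ let $\mathcal H^{(\beta)}(z_0,K,\varepsilon)$ be the set of continuously differentiable functions $S:(0,1]\to\mathbb R$ with $\sup_{0<x\le 1}|S(x)|\le 1-\varepsilon$ and $|S(x)-S(z_0)|\le K|x-z_0|^\beta$ for all $x\in(0,1]$. Put $$d_n=\frac{n}{\ln n},\qquad N(\beta)=d_n^{\beta/(2\beta+1)},\qquad h(\beta)=d_n^{-1/(2\beta+1)},$$ and define the adaptive risk of an estimator $\tilde S_n$ (a measurable function of $y_1,\dots,y_n$) by $$\mathcal R_n(\tilde S_n)=\sup_{\beta\in[\beta_*,\beta^*]}\ \sup_{S\in\mathcal H^{(\beta)}(z_0,K,\varepsilon)} N(\beta)\,\mathbf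 E_S|\tilde S_n-S(z_0)|.$$ Sequential kernel estimators. For $h>0$ let $H=nh$, let $Q$ be the indicator function of $[-1,1]$, $u_j=(j/n-z_0)/h$ and $A_k=\sum_{j=1}^k Q(u_j)y_{j-1}^2$. If $A_n\ge H$, let $\tau=\min\{1\le k\le n: A_k\ge H\}$, let $\alpha\in[0,1]$ be determined by $A_{\tau-1}+\alpha\,Q(u_\tau)y_{\tau-1}^2=H$, and put $$S^*_h=\frac1H\Big(\sum_{j=1}^{\tau-1}Q(u_j)y_{j-1}y_j+\alpha\,Q(u_\tau)y_{\tau-1}y_\tau\Big);$$ if $A_n<H$, put $S^*_h=0$. Adaptive estimator. Let $m=\lfloor\ln d_n\rfloor+1$, $\beta_k=\beta_*+\frac km(\beta^*-\beta_*)$, $N_k=N(\beta_k)$ and $h_k=h(\beta_k)$. Fix $\lambda>K+e\sqrt{4+\frac{4}{2\beta_*+1}}$ and let $$\omega(h_j)=\max_{0\le k\le j}\Big(|S^*_{h_j}-S^*_{h_k}|-\frac{\lambda}{N_{k+1}}\Big),\qquad \hat k=\inf\Big\{0\le j\le m:\ \omega(h_j)\ge\frac{\lambda}{N_j}\Big\}-1,$$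 with $\hat k=m$ if there is no such $j$, and $\hat S_n=S^*_{h_{\hat k}}$. Theorem. The function $\hat S_n$ of the observations is measurable, and $$\limsup_{n\to\infty}\mathcal R_n(\hat S_n)<\infty .$$ -/

import Mathlib

open MeasureTheory ProbabilityTheory Filter Set
open scoped ENNReal BigOperators

noncomputable section

namespace NonparamAR

/-! ### The observation model `y_k = S(k/n) y_{k-1} + ξ_k`, `1 ≤ k ≤ n`, `y_0 = 0` -/

/-- A vector `(v_1, …, v_n)`, written as a sequence indexed by `ℕ` (the entry in place `k` is `v_k`
for `1 ≤ k ≤ n`), with the value `0` in place `0` and beyond place `n`. -/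
def entry {n : ℕ} (v : Fin n → ℝ) : ℕ → ℝ
  | 0 => 0
  | k + 1 => if h : k < n then v ⟨k, h⟩ else 0

/-- The autoregression `y_0 = 0`, `y_k = S(k/n) y_{k-1} + ξ_k`. -/
def path (n : ℕ) (S : ℝ → ℝ) (ξ : ℕ → ℝ) : ℕ → ℝ
  | 0 => 0
  | k + 1 => S (((k + 1 : ℕ) : ℝ) / (n : ℝ)) * path n S ξ k + ξ (k + 1)

/-- The observations `(y_1, …, y_n)` as a function of the noise `(ξ_1, …, ξ_n)`. -/
def observations (n : ℕ) (S : ℝ → ℝ) (ξ : Fin n → ℝ) : Fin n → ℝ :=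
  fun i => path n S (entry ξ) ((i : ℕ) + 1)

/-- The law of `n` independent standard Gaussian variables. -/
def noiseLaw (n : ℕ) : Measure (Fin n → ℝ) :=
  Measure.pi fun _ : Fin n => gaussianReal 0 1

/-- The law `P_S` of the vector `(y_1, …, y_n)`. -/
def observationLaw (n : ℕ) (S : ℝ → ℝ) : Measure (Fin n → ℝ) :=
  (noiseLaw n).map (observations n S)

theorem measurable_observations (n : ℕ) (S : ℝ → ℝ) : Measurable (observations n S) := by
  have key : ∀ k : ℕ, Measurable fun ξ : Fin n → ℝ => path n S (entry ξ) k := by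
    intro k
    induction k with
    | zero => simp only [path]; exact measurable_const
    | succ k ih =>
      simp only [path, entry]
      refine (ih.const_mul _).add ?_
      by_cases h : k < n
      · simp only [h, dif_pos]; exact measurable_pi_apply _
      · simp only [h, dif_neg, not_false_eq_true]; exact measurable_const
  exact measurable_pi_lambda _ fun i => key _

instance isProbabilityMeasure_observationLaw (n : ℕ) (S : ℝ → ℝ) :
    IsProbabilityMeasure (observationLaw n S) := by
  have : IsProbabilityMeasure (noiseLaw n) := by unfold noiseLaw; infer_instance
  exact Measure.isProbabilityMeasure_map (measurable_observations n S).aemeasurable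

/-! ### The function classes and the adaptive risk -/

/-- The stability set `Γ_ε`: functions that are continuously differentiable on `]0,1]` and bounded
there by `1 - ε` in absolute value. (Values outside `]0,1]` play no role.) -/
def stabilitySet (ε : ℝ) : Set (ℝ → ℝ) :=
  {S | ContDiffOn ℝ 1 S (Ioc 0 1) ∧ ∀ x ∈ Ioc (0 : ℝ) 1, |S x| ≤ 1 - ε}

/-- The stable local Hölder class `H^(β)(z₀, K, ε)`. -/
def holderClass (β z₀ K ε : ℝ) : Set (ℝ → ℝ) :=
  {S | S ∈ stabilitySet ε ∧ ∀ x ∈ Ioc (0 : ℝ) 1, |S x - S z₀| ≤ K * |x - z₀| ^ β}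

/-- `d_n = n / ln n`. -/
def dn (n : ℕ) : ℝ := (n : ℝ) / Real.log n

/-- The rate `N(β) = (n / ln n)^(β/(2β+1))`. -/
def rate (n : ℕ) (β : ℝ) : ℝ := dn n ^ (β / (2 * β + 1))

/-- The bandwidth `h(β) = (1/d_n)^(1/(2β+1))`. -/
def bandwidth (n : ℕ) (β : ℝ) : ℝ := (1 / dn n) ^ (1 / (2 * β + 1))

/-- The adaptive risk of an estimator `T` of `S(z₀)` over the regularities `β ∈ [b, B]`:
the supremum over `β` and over `S` in the class of regularity `β` of
`N(β) E_S |T(y_1, …, y_n) - S(z₀)|`. -/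
def risk (b B z₀ K ε : ℝ) (n : ℕ) (T : (Fin n → ℝ) → ℝ) : ℝ≥0∞ :=
  ⨆ β ∈ Icc b B, ⨆ S ∈ holderClass β z₀ K ε,
    ENNReal.ofReal (rate n β) * ∫⁻ Y, ENNReal.ofReal |T Y - S z₀| ∂(observationLaw n S)

/-! ### The truncated sequential kernel estimator -/

/-- The kernel: the indicator function of `[-1, 1]`. -/
def kernelQ (u : ℝ) : ℝ := (Icc (-1 : ℝ) 1).indicator (fun _ => 1) u

/-- The weight `Q(u_j)` with `u_j = (j/n - z₀)/h`. -/
def weight (n : ℕ) (z₀ h : ℝ) (j : ℕ) : ℝ := kernelQ (((j : ℝ) / (n : ℝ) - z₀) / h)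

/-- `A_k = ∑_{j=1}^k Q(u_j) y_{j-1}²`. -/
def energy {n : ℕ} (z₀ h : ℝ) (Y : Fin n → ℝ) (k : ℕ) : ℝ :=
  ∑ j ∈ Finset.Icc 1 k, weight n z₀ h j * entry Y (j - 1) ^ 2

/-- The stopping time `τ_H = inf {1 ≤ k ≤ n : A_k ≥ H}`. It is only used when `A_n ≥ H`. -/
def stoppingTime {n : ℕ} (z₀ H h : ℝ) (Y : Fin n → ℝ) : ℕ :=
  sInf {k : ℕ | 1 ≤ k ∧ k ≤ n ∧ H ≤ energy z₀ h Y k}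

/-- The correction factor `α_H`, the solution of
`A_{τ_H - 1} + α_H Q(u_{τ_H}) y_{τ_H - 1}² = H`. -/
def alpha {n : ℕ} (z₀ H h : ℝ) (Y : Fin n → ℝ) : ℝ :=
  (H - energy z₀ h Y (stoppingTime z₀ H h Y - 1)) /
    (weight n z₀ h (stoppingTime z₀ H h Y) * entry Y (stoppingTime z₀ H h Y - 1) ^ 2)

/-- The defining property of `α_H`. -/
theorem alpha_spec {n : ℕ} (z₀ H h : ℝ) (Y : Fin n → ℝ) (hH : 0 < H)
    (hA : H ≤ energy z₀ h Y n) :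
    0 ≤ alpha z₀ H h Y ∧ alpha z₀ H h Y ≤ 1 ∧
      energy z₀ h Y (stoppingTime z₀ H h Y - 1) +
        alpha z₀ H h Y * weight n z₀ h (stoppingTime z₀ H h Y) *
          entry Y (stoppingTime z₀ H h Y - 1) ^ 2 = H := by
  have h0 : energy z₀ h Y 0 = 0 := by simp [energy]
  have hn : 1 ≤ n := by
    rcases Nat.eq_zero_or_pos n with rfl | hn
    · rw [h0] at hA; linarith
    · exact hn
  have hmem : stoppingTime z₀ H h Y ∈ {k : ℕ | 1 ≤ k ∧ k ≤ n ∧ H ≤ energy z₀ h Y k} :=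
    Nat.sInf_mem ⟨n, hn, le_rfl, hA⟩
  obtain ⟨h1, h2, h3⟩ := hmem
  have hmin : energy z₀ h Y (stoppingTime z₀ H h Y - 1) < H := by
    by_contra hc
    rw [not_lt] at hc
    rcases Nat.eq_zero_or_pos (stoppingTime z₀ H h Y - 1) with hz | hz
    · rw [hz, h0] at hc; linarith
    · have hle : stoppingTime z₀ H h Y ≤ stoppingTime z₀ H h Y - 1 :=
        Nat.sInf_le ⟨hz, (Nat.sub_le _ _).trans h2, hc⟩
      omega
  have hstep : energy z₀ h Y (stoppingTime z₀ H h Y) =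
      energy z₀ h Y (stoppingTime z₀ H h Y - 1) +
        weight n z₀ h (stoppingTime z₀ H h Y) * entry Y (stoppingTime z₀ H h Y - 1) ^ 2 := by
    obtain ⟨k, hk⟩ : ∃ k, stoppingTime z₀ H h Y = k + 1 := ⟨stoppingTime z₀ H h Y - 1, by omega⟩
    rw [hk]
    simp [energy, Finset.sum_Icc_succ_top]
  have hden : 0 < weight n z₀ h (stoppingTime z₀ H h Y) *
      entry Y (stoppingTime z₀ H h Y - 1) ^ 2 := by linarith
  refine ⟨div_nonneg (by linarith) hden.le, ?_, ?_⟩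
  · unfold alpha
    rw [div_le_one hden]
    linarith
  · rw [mul_assoc]
    unfold alpha
    rw [div_mul_cancel₀ _ hden.ne']
    ring

/-- The truncated sequential kernel estimator `S*_{H,h}(z₀)`, which is set to `0` if `A_n < H`. -/
def seqKernelEstimator {n : ℕ} (z₀ H h : ℝ) (Y : Fin n → ℝ) : ℝ :=
  {Y : Fin n → ℝ | H ≤ energy z₀ h Y n}.indicator
    (fun Y =>
      (1 / H) *
        (∑ j ∈ Finset.Icc 1 (stoppingTime z₀ H h Y - 1),
            weight n z₀ h j * entry Y (j - 1) * entry Y j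
          + alpha z₀ H h Y * weight n z₀ h (stoppingTime z₀ H h Y) *
              entry Y (stoppingTime z₀ H h Y - 1) * entry Y (stoppingTime z₀ H h Y))) Y

/-! ### Lepskiĭ's procedure over a grid of `[b, B]` -/

/-- `m = [ln d_n] + 1`. -/
def gridSize (n : ℕ) : ℕ := ⌊Real.log (dn n)⌋₊ + 1

/-- The grid points `β_k = b + (k/m)(B - b)`. -/
def gridPoint (b B : ℝ) (n k : ℕ) : ℝ := b + (k : ℝ) / (gridSize n : ℝ) * (B - b)

/-- `N_k = N(β_k)`. -/
def gridRate (b B : ℝ) (n k : ℕ) : ℝ := rate n (gridPoint b B n k)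

/-- `h_k = h(β_k)`. -/
def gridBandwidth (b B : ℝ) (n k : ℕ) : ℝ := bandwidth n (gridPoint b B n k)

/-- The estimator `S*_{h_k}(z₀) = S*_{H,h_k}(z₀)` with `H = n h_k`. -/
def gridEstimator (b B z₀ : ℝ) {n : ℕ} (k : ℕ) (Y : Fin n → ℝ) : ℝ :=
  seqKernelEstimator z₀ ((n : ℝ) * gridBandwidth b B n k) (gridBandwidth b B n k) Y

/-- `ω(h_j) = max_{0 ≤ k ≤ j} (|S*_{h_j} - S*_{h_k}| - λ / N_{k+1})`. -/
def omega (b B z₀ lam : ℝ) {n : ℕ} (j : ℕ) (Y : Fin n → ℝ) : ℝ :=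
  (Finset.range (j + 1)).sup' Finset.nonempty_range_add_one fun k =>
    |gridEstimator b B z₀ j Y - gridEstimator b B z₀ k Y| - lam / gridRate b B n (k + 1)

/-- The selected index `inf {0 ≤ j ≤ m : ω(h_j) ≥ λ / N_j} - 1`, which is `m` if there is no
such `j`. -/
def selectedIndex (b B z₀ lam : ℝ) {n : ℕ} (Y : Fin n → ℝ) : ℕ :=
  sInf ({j : ℕ | j ≤ gridSize n ∧ lam / gridRate b B n j ≤ omega b B z₀ lam j Y} ∪
    {gridSize n + 1}) - 1

/-- The adaptive estimator. -/
def adaptiveEstimator (b B z₀ lam : ℝ) (n : ℕ) (Y : Fin n → ℝ) : ℝ :=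
  gridEstimator b B z₀ (selectedIndex b B z₀ lam Y) Y

end NonparamAR

end

noncomputable section

namespace NonparamAR

/-! ### Products of adapted factors under a product law -/

/-! Stopping the energy exactly at level `H` gives the kernel weights total mass `H`. So when the
energy reaches `H`, the error of `S*_h` is a weighted average of `S(j/n) - S(z₀)` over the window,
at most `K h^β`, plus a martingale transform of the noise
(`abs_seqKernelEstimator_sub_sub_noiseTerm_le`). The squared coefficients of this transform sum to
at most `1/H` on every path, so it is sub-Gaussian with variance proxy `1/H`, uniformly in `S`
(`lintegral_exp_noiseTerm_le`). Since `n h(β) = ln n · N(β)²`, it exceeds `x / N_k` with probability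
at most `2 n^(-x²/2)`. The energy misses `H` with exponentially small probability, because each step
in the window multiplies the Laplace transform of the energy by at most `2^(-1/2)`, whatever the
past (`measure_energy_lt_le`).

The grid has mesh at most `1 / ln d_n`, so neighbouring rates differ by a factor at most `e`. Let
`β_{k₀}` be the last grid point below the true `β`. Outside the bad event, every estimator with
index `k < k₀` errs by at most `λ / N_{k+1}`, and those with `j ≤ k₀` by less than `λ / N_j`. Hence
no index up to `k₀` is rejected, the selected one is at least `k₀`, and its acceptance test against
`k₀` gives an error of at most `3λ / N_{k₀}` (`abs_adaptiveEstimator_sub_le`).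

The bad event has probability `O(m / n²)`, and there the loss is at most `2` plus the stochastic
part, whose second moment is bounded. Its contribution is `O(m / n)`, which survives multiplication
by `N(β) ≤ n / ln n` because `m = O(ln n)`. -/

theorem lintegral_prod_adapted_le {n : ℕ} (μ : Measure ℝ) [IsProbabilityMeasure μ]
    (f : ℕ → (Fin n → ℝ) → ℝ≥0∞) (c : ℕ → ℝ≥0∞) (hf : ∀ i, Measurable (f i))
    (hdep : ∀ (i : ℕ) (j : Fin n), i < j → ∀ ξ x, f i (Function.update ξ j x) = f i ξ)
    (hint : ∀ (i : Fin n) ξ, ∫⁻ x, f i (Function.update ξ i x) ∂μ ≤ c i) :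
    ∀ k ≤ n, ∫⁻ ξ, ∏ i ∈ Finset.range k, f i ξ ∂(Measure.pi fun _ : Fin n => μ)
      ≤ ∏ i ∈ Finset.range k, c i := by
  intro k
  induction k with
  | zero => intro _; simp
  | succ k ih =>
    intro hk
    have hm : Measurable fun ξ => ∏ i ∈ Finset.range k, f i ξ :=
      Finset.measurable_prod _ fun i _ => hf i
    calc ∫⁻ ξ, ∏ i ∈ Finset.range (k + 1), f i ξ ∂(Measure.pi fun _ : Fin n => μ)
        ≤ ∫⁻ ξ, (∏ i ∈ Finset.range k, f i ξ) * c k ∂(Measure.pi fun _ : Fin n => μ) := by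
          -- Tower property: coordinate `k` is integrated out alone, the earlier factors being
          -- constant in it.
          refine lintegral_le_of_lmarginal_le {⟨k, hk⟩} ?_ ?_ ?_
          · exact Finset.measurable_prod _ fun i _ => hf i
          · exact hm.mul_const _
          · intro ξ
            rw [lmarginal_singleton, lmarginal_singleton]
            have h : ∀ x, ∏ i ∈ Finset.range k, f i (Function.update ξ ⟨k, hk⟩ x)
                = ∏ i ∈ Finset.range k, f i ξ := fun x =>
              Finset.prod_congr rfl fun i hi => hdep i _ (Finset.mem_range.1 hi) _ _
            have hu : Measurable fun x : ℝ => Function.update ξ (⟨k, hk⟩ : Fin n) x :=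
              measurable_update ξ
            have hfu : Measurable fun x => f k (Function.update ξ (⟨k, hk⟩ : Fin n) x) :=
              (hf k).comp hu
            simp only [Finset.prod_range_succ, h]
            rw [lintegral_const_mul _ hfu, lintegral_const, measure_univ, mul_one]
            gcongr
            exact hint ⟨k, hk⟩ ξ
      _ = (∫⁻ ξ, ∏ i ∈ Finset.range k, f i ξ ∂(Measure.pi fun _ : Fin n => μ)) * c k :=
          lintegral_mul_const _ hm
      _ ≤ _ := by
          rw [Finset.prod_range_succ]
          gcongr
          exact ih (by omega)

/-! ### Gaussian integrals -/

theorem lintegral_exp_sub_gaussianReal (a : ℝ) :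
    ∫⁻ x, ENNReal.ofReal (Real.exp (a * x - a ^ 2 / 2)) ∂(gaussianReal 0 1) = 1 := by
  have hint : Integrable (fun x => Real.exp (a * x)) (gaussianReal 0 1) :=
    integrable_exp_mul_gaussianReal a
  have hmgf : ∫ x, Real.exp (a * x) ∂(gaussianReal 0 1) = Real.exp (a ^ 2 / 2) := by
    have h := congrFun (mgf_id_gaussianReal (μ := 0) (v := 1)) a
    simpa [mgf] using h
  simp only [Real.exp_sub]
  rw [← ofReal_integral_eq_lintegral_ofReal (hint.div_const _)
    (Eventually.of_forall fun x => by positivity), integral_div, hmgf,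
    div_self (Real.exp_pos _).ne', ENNReal.ofReal_one]

/-- Completing the square, `-x²/2 - (a+x)²/2 = -(x + a/2)² - a²/4`, so the worst shift is `a = 0`,
with value `1/√2`. Uniformity in `a` is what allows an arbitrary past. -/
theorem lintegral_exp_neg_sq_gaussianReal (a : ℝ) :
    ∫⁻ x, ENNReal.ofReal (Real.exp (-(a + x) ^ 2 / 2)) ∂(gaussianReal 0 1)
      ≤ ENNReal.ofReal (Real.exp (-(Real.log 2 / 2))) := by
  have hsplit : ∀ x : ℝ, gaussianPDF 0 1 x * ENNReal.ofReal (Real.exp (-(a + x) ^ 2 / 2))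
      ≤ ENNReal.ofReal ((√(2 * Real.pi))⁻¹ * Real.exp (-1 * (x + a / 2) ^ 2)) := by
    intro x
    rw [gaussianPDF, ← ENNReal.ofReal_mul (gaussianPDFReal_nonneg _ _ _)]
    refine ENNReal.ofReal_le_ofReal ?_
    simp only [gaussianPDFReal, NNReal.coe_one, mul_one, sub_zero]
    rw [mul_assoc, ← Real.exp_add]
    gcongr
    nlinarith [sq_nonneg a]
  have hI : Integrable fun x : ℝ => Real.exp (-1 * (x + a / 2) ^ 2) :=
    (integrable_exp_neg_mul_sq one_pos).comp_add_right (a / 2)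
  have hlog : Real.exp (-(Real.log 2 / 2)) = (√2)⁻¹ := by
    rw [Real.exp_neg, Real.sqrt_eq_rpow, Real.rpow_def_of_pos two_pos]
    congr 2
    ring
  rw [gaussianReal_of_var_ne_zero _ one_ne_zero,
    lintegral_withDensity_eq_lintegral_mul _ (measurable_gaussianPDF 0 1) (by fun_prop)]
  refine (lintegral_mono hsplit).trans ?_
  rw [← ofReal_integral_eq_lintegral_ofReal (hI.const_mul _)
    (Eventually.of_forall fun x => by positivity), integral_const_mul,
    integral_add_right_eq_self (fun x : ℝ => Real.exp (-1 * x ^ 2)), integral_gaussian, hlog]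
  refine ENNReal.ofReal_le_ofReal (le_of_eq ?_)
  have hpi : √Real.pi ≠ 0 := (Real.sqrt_pos.2 Real.pi_pos).ne'
  rw [div_one, Real.sqrt_mul zero_le_two, mul_inv, mul_assoc, inv_mul_cancel₀ hpi, mul_one]

/-! ### Dependence of the model on the noise coordinates -/

theorem entry_of_le {n : ℕ} (v : Fin n → ℝ) (i : Fin n) : entry v ((i : ℕ) + 1) = v i := by
  simp [entry]

theorem measurable_entry {n : ℕ} (k : ℕ) : Measurable fun v : Fin n → ℝ => entry v k := by
  cases k with
  | zero => exact measurable_const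
  | succ k =>
    by_cases h : k < n
    · simp only [entry, h, dif_pos]; exact measurable_pi_apply _
    · simp only [entry, h, dif_neg, not_false_eq_true]; exact measurable_const

theorem entry_update_of_le {n : ℕ} (v : Fin n → ℝ) (j : Fin n) (x : ℝ) {k : ℕ} (hk : k ≤ j) :
    entry (Function.update v j x) k = entry v k := by
  cases k with
  | zero => rfl
  | succ k =>
    simp only [entry]
    split_ifs with h
    · rw [Function.update_of_ne]
      intro hc
      have := congrArg Fin.val hc
      simp at this
      omega
    · rfl

theorem path_update_of_le {n : ℕ} (S : ℝ → ℝ) (ξ : Fin n → ℝ) (j : Fin n) (x : ℝ) {k : ℕ}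
    (hk : k ≤ j) : path n S (entry (Function.update ξ j x)) k = path n S (entry ξ) k := by
  induction k with
  | zero => rfl
  | succ k ih =>
    simp only [path]
    rw [ih (by omega), entry_update_of_le ξ j x hk]

theorem entry_observations {n : ℕ} (S : ℝ → ℝ) (ξ : Fin n → ℝ) {k : ℕ} (hk : k ≤ n) :
    entry (observations n S ξ) k = path n S (entry ξ) k := by
  cases k with
  | zero => rfl
  | succ k =>
    have h : k < n := hk
    simp only [entry, h, dif_pos, observations]

theorem entry_observations_update {n : ℕ} (S : ℝ → ℝ) (ξ : Fin n → ℝ) (j : Fin n) (x : ℝ) {k : ℕ}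
    (hk : k ≤ j) : entry (observations n S (Function.update ξ j x)) k
      = entry (observations n S ξ) k := by
  have := j.isLt
  rw [entry_observations _ _ (by omega), entry_observations _ _ (by omega),
    path_update_of_le S ξ j x hk]

theorem entry_observations_succ {n : ℕ} (S : ℝ → ℝ) (ξ : Fin n → ℝ) {k : ℕ} (hk : k + 1 ≤ n) :
    entry (observations n S ξ) (k + 1)
      = S (((k + 1 : ℕ) : ℝ) / n) * entry (observations n S ξ) k + entry ξ (k + 1) := by
  rw [entry_observations _ _ hk, entry_observations _ _ (by omega)]
  rfl

instance isProbabilityMeasure_noiseLaw (n : ℕ) : IsProbabilityMeasure (noiseLaw n) := by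
  unfold noiseLaw; infer_instance

/-! ### Exponential bounds -/

/-- Exponential supermartingale: each factor `exp(t aᵢ ξ - (t aᵢ)²/2)` has conditional mean one
since `aᵢ` sees only earlier noise, and the pathwise bound on the quadratic variation pays for the
compensator. -/
theorem lintegral_exp_predictable_sum_le {n : ℕ} (a : ℕ → (Fin n → ℝ) → ℝ)
    (ha : ∀ i, Measurable (a i))
    (hdep : ∀ (i : ℕ) (j : Fin n), i ≤ j → ∀ ξ x, a i (Function.update ξ j x) = a i ξ)
    {V : ℝ} (hV : ∀ ξ, ∑ i ∈ Finset.range n, a i ξ ^ 2 ≤ V) (t : ℝ) :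
    ∫⁻ ξ, ENNReal.ofReal (Real.exp (t * ∑ i ∈ Finset.range n, a i ξ * entry ξ (i + 1)))
      ∂(noiseLaw n) ≤ ENNReal.ofReal (Real.exp (t ^ 2 * V / 2)) := by
  set f : ℕ → (Fin n → ℝ) → ℝ≥0∞ := fun i ξ =>
    ENNReal.ofReal (Real.exp ((t * a i ξ) * entry ξ (i + 1) - (t * a i ξ) ^ 2 / 2)) with hf
  have hprod : ∫⁻ ξ, ∏ i ∈ Finset.range n, f i ξ ∂(noiseLaw n) ≤ 1 := by
    have h := lintegral_prod_adapted_le (gaussianReal 0 1) f (fun _ => 1) ?_ ?_ ?_ n le_rfl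
    · simpa [noiseLaw] using h
    · intro i
      have h1 := ha i
      have h2 := measurable_entry (n := n) (i + 1)
      simp only [hf]
      fun_prop
    · intro i j hij ξ x
      simp only [hf]
      rw [hdep i j hij.le, entry_update_of_le ξ j x (by omega)]
    · intro i ξ
      simp only [hf, hdep i i le_rfl, entry_of_le, Function.update_self]
      exact (lintegral_exp_sub_gaussianReal _).le
  have hpt : ∀ ξ, ENNReal.ofReal (Real.exp (t * ∑ i ∈ Finset.range n, a i ξ * entry ξ (i + 1)))
      ≤ (∏ i ∈ Finset.range n, f i ξ) * ENNReal.ofReal (Real.exp (t ^ 2 * V / 2)) := by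
    intro ξ
    simp only [hf]
    rw [← ENNReal.ofReal_prod_of_nonneg (fun i _ => (Real.exp_pos _).le), ← Real.exp_sum,
      ← ENNReal.ofReal_mul (Real.exp_pos _).le, ← Real.exp_add]
    refine ENNReal.ofReal_le_ofReal (Real.exp_le_exp.2 ?_)
    rw [Finset.sum_sub_distrib]
    have h1 : ∑ i ∈ Finset.range n, (t * a i ξ) * entry ξ (i + 1)
        = t * ∑ i ∈ Finset.range n, a i ξ * entry ξ (i + 1) := by
      rw [Finset.mul_sum]
      exact Finset.sum_congr rfl fun i _ => by ring
    have h2 : ∑ i ∈ Finset.range n, (t * a i ξ) ^ 2 / 2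
        = t ^ 2 / 2 * ∑ i ∈ Finset.range n, a i ξ ^ 2 := by
      rw [Finset.mul_sum]
      exact Finset.sum_congr rfl fun i _ => by ring
    rw [h1, h2]
    nlinarith [mul_le_mul_of_nonneg_left (hV ξ) (by positivity : (0:ℝ) ≤ t ^ 2 / 2)]
  calc _ ≤ ∫⁻ ξ, (∏ i ∈ Finset.range n, f i ξ) * ENNReal.ofReal (Real.exp (t ^ 2 * V / 2))
          ∂(noiseLaw n) := lintegral_mono hpt
    _ = (∫⁻ ξ, ∏ i ∈ Finset.range n, f i ξ ∂(noiseLaw n))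
          * ENNReal.ofReal (Real.exp (t ^ 2 * V / 2)) :=
        lintegral_mul_const' _ _ ENNReal.ofReal_ne_top
    _ ≤ 1 * ENNReal.ofReal (Real.exp (t ^ 2 * V / 2)) := by gcongr
    _ = _ := one_mul _

theorem measure_le_of_lintegral_exp_le {Ω : Type*} [MeasurableSpace Ω] (P : Measure Ω)
    (X : Ω → ℝ) (hX : Measurable X) {A : ℝ}
    (h : ∫⁻ ω, ENNReal.ofReal (Real.exp (X ω)) ∂P ≤ ENNReal.ofReal (Real.exp A)) (x : ℝ) :
    P {ω | x ≤ X ω} ≤ ENNReal.ofReal (Real.exp (A - x)) := by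
  have hsub : {ω | x ≤ X ω}
      ⊆ {ω | ENNReal.ofReal (Real.exp x) ≤ ENNReal.ofReal (Real.exp (X ω))} := fun ω hω =>
    ENNReal.ofReal_le_ofReal (Real.exp_le_exp.2 hω)
  refine (measure_mono hsub).trans ?_
  have hm := meas_ge_le_lintegral_div (μ := P)
    (f := fun ω => ENNReal.ofReal (Real.exp (X ω))) (by fun_prop)
    (ε := ENNReal.ofReal (Real.exp x)) (by simp [Real.exp_pos]) ENNReal.ofReal_ne_top
  refine hm.trans ?_
  rw [Real.exp_sub, ENNReal.ofReal_div_of_pos (Real.exp_pos _)]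
  gcongr

theorem measure_abs_ge_le_of_lintegral_exp_le {Ω : Type*} [MeasurableSpace Ω] (P : Measure Ω)
    (X : Ω → ℝ) (hX : Measurable X) {v : ℝ} (hv : 0 < v)
    (h : ∀ t : ℝ, ∫⁻ ω, ENNReal.ofReal (Real.exp (t * X ω)) ∂P
      ≤ ENNReal.ofReal (Real.exp (t ^ 2 * v / 2))) {x : ℝ} (hx : 0 ≤ x) :
    P {ω | x ≤ |X ω|} ≤ 2 * ENNReal.ofReal (Real.exp (-(x ^ 2 / (2 * v)))) := by
  -- The Chernoff exponent is optimal at `t = ± x / v`; both signs are treated together.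
  have key : ∀ t : ℝ, t ^ 2 = (x / v) ^ 2 → P {ω | x ^ 2 / v ≤ t * X ω}
      ≤ ENNReal.ofReal (Real.exp (-(x ^ 2 / (2 * v)))) := by
    intro t ht
    have := measure_le_of_lintegral_exp_le P (fun ω => t * X ω) (by fun_prop) (h t) (x ^ 2 / v)
    refine this.trans_eq ?_
    congr 2
    rw [ht]
    field_simp
    ring
  have hsub : {ω | x ≤ |X ω|} ⊆ {ω | x ^ 2 / v ≤ (x / v) * X ω} ∪ {ω | x ^ 2 / v ≤ (-(x / v)) * X ω} := by
    intro ω hω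
    have hxv : 0 ≤ x / v := by positivity
    have heq : x ^ 2 / v = x / v * x := by ring
    rcases le_abs.1 (show x ≤ |X ω| from hω) with h1 | h1
    · left
      show x ^ 2 / v ≤ (x / v) * X ω
      rw [heq]; gcongr
    · right
      show x ^ 2 / v ≤ (-(x / v)) * X ω
      have := mul_le_mul_of_nonneg_left h1 hxv
      rw [heq]; linarith
  calc _ ≤ _ := measure_mono hsub
    _ ≤ _ := measure_union_le _ _
    _ ≤ _ := add_le_add (key _ rfl) (key _ (by ring))
    _ = _ := (two_mul _).symm

/-- Uses `u² ≤ e^u + e^(-u)` and the exponential bound at `t = ± 1`, where each side is at most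
`e^(1/2) ≤ 2`. -/
theorem lintegral_sq_le_of_lintegral_exp_le {Ω : Type*} [MeasurableSpace Ω] (P : Measure Ω)
    (X : Ω → ℝ) (hX : Measurable X) {v : ℝ} (hv : v ≤ 1)
    (h : ∀ t : ℝ, ∫⁻ ω, ENNReal.ofReal (Real.exp (t * X ω)) ∂P
      ≤ ENNReal.ofReal (Real.exp (t ^ 2 * v / 2))) :
    ∫⁻ ω, ENNReal.ofReal (X ω ^ 2) ∂P ≤ ENNReal.ofReal 4 := by
  have hpt : ∀ u : ℝ, ENNReal.ofReal (u ^ 2)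
      ≤ ENNReal.ofReal (Real.exp (1 * u)) + ENNReal.ofReal (Real.exp (-1 * u)) := by
    intro u
    rw [← ENNReal.ofReal_add (Real.exp_pos _).le (Real.exp_pos _).le]
    refine ENNReal.ofReal_le_ofReal ?_
    have hpos : ∀ s : ℝ, 0 ≤ s → s ^ 2 ≤ Real.exp s + Real.exp (-s) := by
      intro s hs
      have h1 := Real.sum_le_exp_of_nonneg hs 4
      simp [Finset.sum_range_succ, Nat.factorial] at h1
      have h2 := Real.one_sub_le_exp_neg s
      have h3 : 0 ≤ s ^ 3 := by positivity
      have h4 := Real.exp_pos (-s)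
      nlinarith [sq_nonneg (s - 2), mul_nonneg hs (sq_nonneg (s - 3 / 2))]
    rcases le_total 0 u with hu | hu
    · simpa using hpos u hu
    · have := hpos (-u) (by linarith)
      rw [neg_neg, neg_sq] at this
      rw [one_mul, neg_one_mul, add_comm]
      exact this
  have hexp : Real.exp (1 / 2) ≤ 2 := by
    have h1 := Real.exp_one_lt_d9
    have h2 : Real.exp (1 / 2) * Real.exp (1 / 2) = Real.exp 1 := by
      rw [← Real.exp_add]; norm_num
    have h3 := Real.exp_pos (1 / 2)
    nlinarith
  have hside : ∀ t : ℝ, t ^ 2 = 1 → ∫⁻ ω, ENNReal.ofReal (Real.exp (t * X ω)) ∂P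
      ≤ ENNReal.ofReal 2 := by
    intro t ht
    refine (h t).trans (ENNReal.ofReal_le_ofReal (le_trans (Real.exp_le_exp.2 ?_) hexp))
    rw [ht]; linarith
  calc _ ≤ ∫⁻ ω, (ENNReal.ofReal (Real.exp (1 * X ω)) + ENNReal.ofReal (Real.exp (-1 * X ω))) ∂P :=
        lintegral_mono fun ω => hpt _
    _ = _ := lintegral_add_left (by fun_prop) _
    _ ≤ ENNReal.ofReal 2 + ENNReal.ofReal 2 := add_le_add (hside 1 (by norm_num)) (hside (-1) (by norm_num))
    _ = _ := by rw [← ENNReal.ofReal_add (by norm_num) (by norm_num)]; norm_num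

/-! ### The truncated predictable weights -/

theorem sum_Icc_one_eq_sum_range (F : ℕ → ℝ) (k : ℕ) :
    ∑ j ∈ Finset.Icc 1 k, F j = ∑ i ∈ Finset.range k, F (i + 1) := by
  induction k with
  | zero => simp
  | succ k ih => rw [Finset.sum_Icc_succ_top (by omega), ih, Finset.sum_range_succ]

theorem weight_eq_zero_or_one (n : ℕ) (z₀ h : ℝ) (j : ℕ) :
    weight n z₀ h j = 0 ∨ weight n z₀ h j = 1 := by
  unfold weight kernelQ
  exact (Set.indicator_eq_zero_or_self _ _ _)

theorem weight_nonneg (n : ℕ) (z₀ h : ℝ) (j : ℕ) : 0 ≤ weight n z₀ h j := by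
  rcases weight_eq_zero_or_one n z₀ h j with e | e <;> simp [e]

theorem weight_le_one (n : ℕ) (z₀ h : ℝ) (j : ℕ) : weight n z₀ h j ≤ 1 := by
  rcases weight_eq_zero_or_one n z₀ h j with e | e <;> simp [e]

theorem weight_eq_one_iff (n : ℕ) (z₀ : ℝ) {h : ℝ} (hh : 0 < h) (j : ℕ) :
    weight n z₀ h j = 1 ↔ |(j : ℝ) / n - z₀| ≤ h := by
  unfold weight kernelQ
  rw [Set.indicator_apply]
  have : ((j : ℝ) / n - z₀) / h ∈ Icc (-1 : ℝ) 1 ↔ |(j : ℝ) / n - z₀| ≤ h := by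
    rw [mem_Icc, ← abs_le, abs_div, abs_of_pos hh, div_le_one hh]
  split_ifs with hc
  · simp [this.1 hc]
  · simp [mt this.2 hc]

section SequentialEstimator

variable {n : ℕ} (z₀ H h : ℝ) (Y : Fin n → ℝ)

theorem energy_zero : energy z₀ h Y 0 = 0 := by simp [energy]

theorem energy_succ (k : ℕ) :
    energy z₀ h Y (k + 1) = energy z₀ h Y k + weight n z₀ h (k + 1) * entry Y k ^ 2 := by
  simp [energy, Finset.sum_Icc_succ_top]

theorem monotone_energy : Monotone (energy z₀ h Y) := by
  refine monotone_nat_of_le_succ fun k => ?_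
  rw [energy_succ]
  have := weight_nonneg n z₀ h (k + 1)
  nlinarith [mul_nonneg this (sq_nonneg (entry Y k))]

/-- The weights of the sequential estimator: the kernel weights up to the stopping time, with the
correction factor there, and zero afterwards. -/
def truncWeight (j : ℕ) : ℝ :=
  if energy z₀ h Y j < H then weight n z₀ h j
  else if energy z₀ h Y (j - 1) < H then
    (H - energy z₀ h Y (j - 1)) / (weight n z₀ h j * entry Y (j - 1) ^ 2) * weight n z₀ h j
  else 0

/-- The truncated weights are built so that their energy increments are those of `min (A_k) H`;
summation then telescopes. -/
theorem truncWeight_succ_mul_sq (k : ℕ) :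
    truncWeight z₀ H h Y (k + 1) * entry Y k ^ 2
      = min (energy z₀ h Y (k + 1)) H - min (energy z₀ h Y k) H := by
  have hle := monotone_energy z₀ h Y (Nat.le_succ k)
  have hs := energy_succ z₀ h Y k
  unfold truncWeight
  simp only [Nat.add_sub_cancel]
  split_ifs with h1 h2
  · rw [min_eq_left h1.le, min_eq_left (hle.trans h1.le)]
    linarith
  · rw [min_eq_right (not_lt.1 h1), min_eq_left h2.le]
    -- The energy crosses `H` at this step, so the increment cannot vanish and the division is
    -- genuine.
    have : weight n z₀ h (k + 1) * entry Y k ^ 2 ≠ 0 := by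
      intro h0
      rw [hs, h0] at h1
      exact h1 (by linarith)
    rw [mul_assoc, div_mul_cancel₀ _ this]
  · rw [min_eq_right (not_lt.1 h1), min_eq_right (not_lt.1 h2)]
    simp

theorem truncWeight_succ_nonneg (k : ℕ) : 0 ≤ truncWeight z₀ H h Y (k + 1) := by
  unfold truncWeight
  have hw := weight_nonneg n z₀ h (k + 1)
  split_ifs with h1 h2
  · exact hw
  · exact mul_nonneg (div_nonneg (by linarith) (mul_nonneg hw (sq_nonneg _))) hw
  · exact le_rfl

theorem truncWeight_succ_le_weight (k : ℕ) :
    truncWeight z₀ H h Y (k + 1) ≤ weight n z₀ h (k + 1) := by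
  have hw := weight_nonneg n z₀ h (k + 1)
  have hs := energy_succ z₀ h Y k
  unfold truncWeight
  simp only [Nat.add_sub_cancel]
  split_ifs with h1 h2
  · exact le_rfl
  · refine mul_le_of_le_one_left hw (div_le_one_of_le₀ ?_ (mul_nonneg hw (sq_nonneg _)))
    linarith
  · exact hw

theorem sum_truncWeight_mul_sq (hH : 0 ≤ H) (k : ℕ) :
    ∑ i ∈ Finset.range k, truncWeight z₀ H h Y (i + 1) * entry Y i ^ 2
      = min (energy z₀ h Y k) H := by
  simp only [truncWeight_succ_mul_sq]
  rw [Finset.sum_range_sub (fun k => min (energy z₀ h Y k) H), energy_zero, min_eq_left hH, sub_zero]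

theorem seqKernelEstimator_of_lt (hA : energy z₀ h Y n < H) :
    seqKernelEstimator z₀ H h Y = 0 := by
  unfold seqKernelEstimator
  exact Set.indicator_of_notMem (by simpa using hA) _

/-- Trades the random upper limit `τ` for a fixed range: the weight at `i + 1` depends on the
observations up to `i` only, so the sum becomes a martingale transform after substituting the
recursion. -/
theorem seqKernelEstimator_of_le (hH : 0 < H) (hA : H ≤ energy z₀ h Y n) :
    seqKernelEstimator z₀ H h Y
      = (1 / H) * ∑ i ∈ Finset.range n,
          truncWeight z₀ H h Y (i + 1) * entry Y i * entry Y (i + 1) := by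
  have hn : 1 ≤ n := by
    rcases Nat.eq_zero_or_pos n with rfl | hn
    · rw [energy_zero] at hA; linarith
    · exact hn
  have hmem : stoppingTime z₀ H h Y ∈ {k : ℕ | 1 ≤ k ∧ k ≤ n ∧ H ≤ energy z₀ h Y k} :=
    Nat.sInf_mem ⟨n, hn, le_rfl, hA⟩
  obtain ⟨t, ht⟩ : ∃ t, stoppingTime z₀ H h Y = t + 1 :=
    ⟨stoppingTime z₀ H h Y - 1, by have := hmem.1; omega⟩
  rw [ht] at hmem
  obtain ⟨-, h2, h3⟩ := hmem
  have hmin : energy z₀ h Y t < H := by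
    by_contra hc
    rw [not_lt] at hc
    rcases Nat.eq_zero_or_pos t with hz | hz
    · rw [hz, energy_zero] at hc; linarith
    · have hle : stoppingTime z₀ H h Y ≤ t := Nat.sInf_le ⟨hz, by omega, hc⟩
      omega
  unfold seqKernelEstimator
  rw [Set.indicator_of_mem (by simpa using hA)]
  congr 1
  rw [ht, Nat.add_sub_cancel, sum_Icc_one_eq_sum_range]
  have hbefore : ∀ i ∈ Finset.range t, weight n z₀ h (i + 1) * entry Y (i + 1 - 1) * entry Y (i + 1)
      = truncWeight z₀ H h Y (i + 1) * entry Y i * entry Y (i + 1) := by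
    intro i hi
    have := monotone_energy z₀ h Y (show i + 1 ≤ t from Finset.mem_range.1 hi)
    rw [truncWeight, if_pos (this.trans_lt hmin), Nat.add_sub_cancel]
  have hat : alpha z₀ H h Y * weight n z₀ h (t + 1) = truncWeight z₀ H h Y (t + 1) := by
    rw [truncWeight, if_neg (not_lt.2 h3), alpha, ht, Nat.add_sub_cancel, if_pos hmin]
  have hafter : ∀ k, t + 1 ≤ k → ∑ i ∈ Finset.range (t + 1),
      truncWeight z₀ H h Y (i + 1) * entry Y i * entry Y (i + 1)
        = ∑ i ∈ Finset.range k, truncWeight z₀ H h Y (i + 1) * entry Y i * entry Y (i + 1) := by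
    intro k hk
    induction k, hk using Nat.le_induction with
    | base => rfl
    | succ k hk ih =>
      have hE := h3.trans (monotone_energy z₀ h Y hk)
      have hE' := hE.trans (monotone_energy z₀ h Y (Nat.le_succ k))
      rw [Finset.sum_range_succ _ k, ← ih, truncWeight, if_neg (not_lt.2 hE'), Nat.add_sub_cancel,
        if_neg (not_lt.2 hE)]
      ring
  rw [← hafter n h2, Finset.sum_range_succ, Finset.sum_congr rfl hbefore, hat]

/-! ### Decomposition of the estimation error -/

/-- The stochastic part of the sequential kernel estimator, as a function of the noise. -/
def noiseTerm (S : ℝ → ℝ) (ξ : Fin n → ℝ) : ℝ :=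
  ∑ i ∈ Finset.range n, (1 / H * (truncWeight z₀ H h (observations n S ξ) (i + 1)
    * entry (observations n S ξ) i)) * entry ξ (i + 1)

theorem abs_seqKernelEstimator_sub_sub_noiseTerm_le {S : ℝ → ℝ} {ξ : Fin n → ℝ} {h : ℝ}
    (hh : 0 < h) (hH : 0 < H)
    (hA : H ≤ energy z₀ h (observations n S ξ) n) {D : ℝ}
    (hD : ∀ i < n, |((i + 1 : ℕ) : ℝ) / n - z₀| ≤ h → |S (((i + 1 : ℕ) : ℝ) / n) - S z₀| ≤ D) :
    |seqKernelEstimator z₀ H h (observations n S ξ) - S z₀ - noiseTerm z₀ H h S ξ| ≤ D := by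
  set Y := observations n S ξ with hY
  have hsum := sum_truncWeight_mul_sq z₀ H h Y hH.le n
  rw [min_eq_right hA] at hsum
  have hid : seqKernelEstimator z₀ H h Y - S z₀ - noiseTerm z₀ H h S ξ
      = (1 / H) * ∑ i ∈ Finset.range n, truncWeight z₀ H h Y (i + 1) * entry Y i ^ 2
          * (S (((i + 1 : ℕ) : ℝ) / n) - S z₀) := by
    -- Exact stopping makes the total weight `H`, so `S z₀` is itself a weighted average and can be
    -- subtracted term by term.
    have h1 : S z₀ = (1 / H) * ∑ i ∈ Finset.range n,
        truncWeight z₀ H h Y (i + 1) * entry Y i ^ 2 * S z₀ := by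
      rw [← Finset.sum_mul, hsum]
      field_simp
    rw [seqKernelEstimator_of_le z₀ H h Y hH hA, noiseTerm]
    conv_lhs => rw [h1]
    rw [Finset.mul_sum, Finset.mul_sum, Finset.mul_sum, ← Finset.sum_sub_distrib,
      ← Finset.sum_sub_distrib]
    refine Finset.sum_congr rfl fun i hi => ?_
    rw [← hY, hY, entry_observations_succ S ξ (Finset.mem_range.1 hi), ← hY]
    ring
  have hterm : ∀ i ∈ Finset.range n, |truncWeight z₀ H h Y (i + 1) * entry Y i ^ 2
      * (S (((i + 1 : ℕ) : ℝ) / n) - S z₀)| ≤ truncWeight z₀ H h Y (i + 1) * entry Y i ^ 2 * D := by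
    intro i hi
    have hg := truncWeight_succ_nonneg z₀ H h Y i
    rw [abs_mul, abs_of_nonneg (mul_nonneg hg (sq_nonneg _))]
    rcases weight_eq_zero_or_one n z₀ h (i + 1) with hw | hw
    · have h0 : truncWeight z₀ H h Y (i + 1) = 0 :=
        le_antisymm (hw ▸ truncWeight_succ_le_weight z₀ H h Y i) hg
      simp [h0]
    · refine mul_le_mul_of_nonneg_left ?_ (mul_nonneg hg (sq_nonneg _))
      exact hD i (Finset.mem_range.1 hi) ((weight_eq_one_iff n z₀ hh (i + 1)).1 hw)
  rw [hid, abs_mul, abs_of_pos (by positivity : (0:ℝ) < 1 / H), one_div, inv_mul_le_iff₀ hH]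
  calc _ ≤ _ := Finset.abs_sum_le_sum_abs _ _
    _ ≤ _ := Finset.sum_le_sum hterm
    _ = H * D := by rw [← Finset.sum_mul, hsum]

/-! ### Measurability -/

theorem measurable_energy (k : ℕ) : Measurable fun Y : Fin n → ℝ => energy z₀ h Y k := by
  unfold energy
  exact Finset.measurable_sum _ fun j _ => ((measurable_entry (j - 1)).pow_const 2).const_mul _

theorem measurable_truncWeight (j : ℕ) : Measurable fun Y : Fin n → ℝ => truncWeight z₀ H h Y j := by
  unfold truncWeight
  have h1 := measurable_energy (n := n) z₀ h j
  have h2 := measurable_energy (n := n) z₀ h (j - 1)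
  have h3 := measurable_entry (n := n) (j - 1)
  refine Measurable.ite (measurableSet_lt h1 measurable_const) measurable_const
    (Measurable.ite (measurableSet_lt h2 measurable_const) ?_ measurable_const)
  fun_prop

theorem measurable_noiseTerm (S : ℝ → ℝ) :
    Measurable fun ξ : Fin n → ℝ => noiseTerm z₀ H h S ξ := by
  unfold noiseTerm
  refine Finset.measurable_sum _ fun i _ => ?_
  have ho := measurable_observations n S
  have h1 := (measurable_truncWeight (n := n) z₀ H h (i + 1)).comp ho
  have h2 := (measurable_entry (n := n) i).comp ho
  exact ((h1.mul h2).const_mul _).mul (measurable_entry _)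

theorem measurable_nat_sInf {α : Type*} [MeasurableSpace α] {s : α → Set ℕ}
    (hs : ∀ k, MeasurableSet {a | k ∈ s a}) : Measurable fun a => sInf (s a) := by
  refine measurable_to_countable' fun k => ?_
  -- The second piece accounts for the convention `sInf ∅ = 0`.
  have : (fun a => sInf (s a)) ⁻¹' {k}
      = ({a | k ∈ s a} ∩ ⋂ j, ⋂ (_ : j < k), {a | j ∈ s a}ᶜ)
        ∪ ({_a | k = 0} ∩ ⋂ j, {a | j ∈ s a}ᶜ) := by
    ext a
    simp only [mem_preimage, mem_singleton_iff, mem_union, mem_inter_iff, mem_iInter, mem_compl_iff,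
      mem_ofPred_eq]
    constructor
    · rintro rfl
      rcases (s a).eq_empty_or_nonempty with he | he
      · right
        simp [he]
      · left
        exact ⟨Nat.sInf_mem he, fun j hj => Nat.notMem_of_lt_sInf hj⟩
    · rintro (⟨h1, h2⟩ | ⟨h1, h2⟩)
      · refine le_antisymm (Nat.sInf_le h1) ?_
        by_contra hc
        exact h2 _ (not_le.1 hc) (Nat.sInf_mem ⟨k, h1⟩)
      · rw [Set.eq_empty_of_forall_notMem h2, Nat.sInf_empty, h1]
  rw [this]
  exact ((hs k).inter (MeasurableSet.iInter fun j => MeasurableSet.iInter fun _ => (hs j).compl)).union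
    ((MeasurableSet.const _).inter (MeasurableSet.iInter fun j => (hs j).compl))

theorem measurable_apply_nat {α : Type*} [MeasurableSpace α] {f : ℕ → α → ℝ} {g : α → ℕ}
    (hf : ∀ k, Measurable (f k)) (hg : Measurable g) : Measurable fun a => f (g a) a := by
  have : Measurable fun p : ℕ × α => f p.1 p.2 :=
    measurable_from_prod_countable_right hf
  exact this.comp (hg.prodMk measurable_id)

theorem measurable_stoppingTime : Measurable fun Y : Fin n → ℝ => stoppingTime z₀ H h Y :=
  measurable_nat_sInf fun k => ((MeasurableSet.const _).inter ((MeasurableSet.const _).inter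
    (measurableSet_le measurable_const (measurable_energy z₀ h k))))

theorem measurable_seqKernelEstimator :
    Measurable fun Y : Fin n → ℝ => seqKernelEstimator z₀ H h Y := by
  have hτ := measurable_stoppingTime (n := n) z₀ H h
  have hE := measurable_energy (n := n) z₀ h
  have he := measurable_entry (n := n)
  have hα : Measurable fun Y : Fin n → ℝ => alpha z₀ H h Y := by
    refine measurable_apply_nat (f := fun t (Y : Fin n → ℝ) =>
      (H - energy z₀ h Y (t - 1)) / (weight n z₀ h t * entry Y (t - 1) ^ 2)) (fun t => ?_) hτ
    exact ((hE _).const_sub _).div (((he _).pow_const 2).const_mul _)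
  have hmain : ∀ t, Measurable fun Y : Fin n → ℝ => (1 / H) *
      (∑ j ∈ Finset.Icc 1 (t - 1), weight n z₀ h j * entry Y (j - 1) * entry Y j
        + alpha z₀ H h Y * weight n z₀ h t * entry Y (t - 1) * entry Y t) := fun t =>
    ((Finset.measurable_sum _ fun j _ => ((he _).const_mul _).mul (he _)).add
      (((hα.mul_const _).mul (he _)).mul (he _))).const_mul _
  have h := (measurable_apply_nat hmain hτ).indicator
    (measurableSet_le (measurable_const (a := H)) (hE n))
  exact h

theorem measurable_adaptiveEstimator (b B z₀ lam : ℝ) (n : ℕ) :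
    Measurable (adaptiveEstimator b B z₀ lam n) := by
  have hg : ∀ k, Measurable fun Y : Fin n → ℝ => gridEstimator b B z₀ k Y := fun k =>
    measurable_seqKernelEstimator _ _ _
  have hω : ∀ j, Measurable fun Y : Fin n → ℝ => omega b B z₀ lam j Y := by
    intro j
    have := Finset.measurable_sup' (s := Finset.range (j + 1)) Finset.nonempty_range_add_one
      (f := fun k (Y : Fin n → ℝ) => |gridEstimator b B z₀ j Y - gridEstimator b B z₀ k Y|
        - lam / gridRate b B n (k + 1))
      fun k _ => (((hg j).sub (hg k)).abs).sub_const _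
    convert this using 1
    funext Y
    simp [omega, Finset.sup'_apply]
  refine measurable_apply_nat hg ?_
  unfold selectedIndex
  refine (measurable_of_countable fun k : ℕ => k - 1).comp (measurable_nat_sInf fun k => ?_)
  exact ((MeasurableSet.const _).inter (measurableSet_le measurable_const (hω k))).union
    (MeasurableSet.const _)

/-! ### Tails of the stochastic part -/

theorem truncWeight_observations_update (S : ℝ → ℝ) (ξ : Fin n → ℝ) (j : Fin n) (x : ℝ) {i : ℕ}
    (hi : i ≤ j) : truncWeight z₀ H h (observations n S (Function.update ξ j x)) (i + 1)
      = truncWeight z₀ H h (observations n S ξ) (i + 1) := by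
  have hE : ∀ k ≤ i + 1, energy z₀ h (observations n S (Function.update ξ j x)) k
      = energy z₀ h (observations n S ξ) k := by
    intro k hk
    unfold energy
    refine Finset.sum_congr rfl fun l hl => ?_
    rw [entry_observations_update S ξ j x (by have := (Finset.mem_Icc.1 hl).2; omega)]
  unfold truncWeight
  rw [hE _ le_rfl, hE (i + 1 - 1) (by omega), Nat.add_sub_cancel,
    entry_observations_update S ξ j x hi]

/-- As the weights `g` lie in `[0,1]`, `g² ≤ g`, so the quadratic variation is at most `H⁻² · min
(A_n) H ≤ 1/H` on every path, even when the energy never reaches `H`. -/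
theorem lintegral_exp_noiseTerm_le (S : ℝ → ℝ) (hH : 0 < H) (t : ℝ) :
    ∫⁻ ξ, ENNReal.ofReal (Real.exp (t * noiseTerm z₀ H h S ξ)) ∂(noiseLaw n)
      ≤ ENNReal.ofReal (Real.exp (t ^ 2 * (1 / H) / 2)) := by
  refine lintegral_exp_predictable_sum_le (fun i ξ => 1 / H *
    (truncWeight z₀ H h (observations n S ξ) (i + 1) * entry (observations n S ξ) i)) ?_ ?_ ?_ t
  · intro i
    have ho := measurable_observations n S
    exact (((measurable_truncWeight (n := n) z₀ H h (i + 1)).comp ho).mul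
      ((measurable_entry (n := n) i).comp ho)).const_mul _
  · intro i j hij ξ x
    rw [truncWeight_observations_update z₀ H h S ξ j x hij, entry_observations_update S ξ j x hij]
  · intro ξ
    set Y := observations n S ξ
    have hsum := sum_truncWeight_mul_sq z₀ H h Y hH.le n
    have hle : ∑ i ∈ Finset.range n, (truncWeight z₀ H h Y (i + 1) * entry Y i) ^ 2 ≤ H := by
      refine (Finset.sum_le_sum fun i _ => ?_).trans (hsum.le.trans (min_le_right _ _))
      rw [mul_pow]
      have h0 := truncWeight_succ_nonneg z₀ H h Y i
      have h1 := (truncWeight_succ_le_weight z₀ H h Y i).trans (weight_le_one _ _ _ _)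
      gcongr
      nlinarith
    have hfac : ∑ i ∈ Finset.range n, (1 / H * (truncWeight z₀ H h Y (i + 1) * entry Y i)) ^ 2
        = (1 / H) ^ 2 * ∑ i ∈ Finset.range n, (truncWeight z₀ H h Y (i + 1) * entry Y i) ^ 2 := by
      rw [Finset.mul_sum]
      exact Finset.sum_congr rfl fun i _ => mul_pow _ _ _
    rw [hfac]
    calc _ ≤ (1 / H) ^ 2 * H := by gcongr
      _ = 1 / H := by field_simp

/-! ### The energy in the window is large -/

/-- The window holds at least `2nh - 1` nodes; one more is given up because index `1` carries `y_0 =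
0` and adds no energy. -/
theorem two_mul_sub_two_le_sum_weight {h : ℝ} (hh : 0 < h) (hl : h < z₀) (hu : z₀ + h ≤ 1)
    (hn : 0 < n) :
    2 * ((n : ℝ) * h) - 2 ≤ ∑ i ∈ Finset.range (n - 1), weight n z₀ h (i + 2) := by
  have hn' : (0 : ℝ) < n := Nat.cast_pos.2 hn
  set l := ⌈(n : ℝ) * (z₀ - h)⌉₊ with hl_def
  set u := ⌊(n : ℝ) * (z₀ + h)⌋₊ with hu_def
  have hl1 : 1 ≤ l := Nat.ceil_pos.2 (mul_pos hn' (by linarith))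
  have hun : u ≤ n := by
    refine Nat.floor_le_of_le ?_
    nlinarith
  have hone : ∀ j ∈ Finset.Icc l u, weight n z₀ h j = 1 := by
    intro j hj
    obtain ⟨h1, h2⟩ := Finset.mem_Icc.1 hj
    rw [weight_eq_one_iff n z₀ hh, abs_le]
    have h3 : (n : ℝ) * (z₀ - h) ≤ j := Nat.ceil_le.1 h1
    have h4 : (j : ℝ) ≤ n * (z₀ + h) :=
      (Nat.cast_le.2 h2).trans (Nat.floor_le (mul_nonneg hn'.le (by linarith)))
    have h5 : z₀ - h ≤ (j : ℝ) / n := by rw [le_div_iff₀ hn']; linarith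
    have h6 : (j : ℝ) / n ≤ z₀ + h := by rw [div_le_iff₀ hn']; linarith
    constructor <;> linarith
  have hcard : (2 * ((n : ℝ) * h) - 1) ≤ ((Finset.Icc l u).card : ℝ) := by
    rw [Nat.card_Icc]
    have h1 : (n : ℝ) * (z₀ + h) < u + 1 := Nat.lt_floor_add_one _
    have h2 : (l : ℝ) < n * (z₀ - h) + 1 :=
      Nat.ceil_lt_add_one (mul_nonneg hn'.le (by linarith))
    have h3 : ((u + 1 : ℕ) : ℝ) - l ≤ ((u + 1 - l : ℕ) : ℝ) := by
      rw [sub_le_iff_le_add]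
      exact_mod_cast (by omega : u + 1 ≤ u + 1 - l + l)
    push_cast at h3 ⊢
    linarith
  have hsub : (Finset.Icc l u) ⊆ Finset.Icc 1 n := Finset.Icc_subset_Icc hl1 hun
  have hsum : ((Finset.Icc l u).card : ℝ) ≤ ∑ j ∈ Finset.Icc 1 n, weight n z₀ h j := by
    calc ((Finset.Icc l u).card : ℝ) = ∑ j ∈ Finset.Icc l u, weight n z₀ h j := by
          rw [Finset.sum_congr rfl hone]; simp
      _ ≤ _ := Finset.sum_le_sum_of_subset_of_nonneg hsub fun _ _ _ => weight_nonneg _ _ _ _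
  obtain ⟨m, rfl⟩ : ∃ m, n = m + 1 := ⟨n - 1, by omega⟩
  rw [sum_Icc_one_eq_sum_range, Finset.sum_range_succ'] at hsum
  have := weight_le_one (m + 1) z₀ h (0 + 1)
  rw [Nat.add_sub_cancel]
  linarith

/-- Given the past, `y_{i+1}` is a shifted standard Gaussian, so every node in the window costs a
factor `2^(-1/2)` regardless of `S`. -/
theorem lintegral_exp_neg_energy_le (S : ℝ → ℝ) :
    ∫⁻ ξ, ENNReal.ofReal (Real.exp (-(energy z₀ h (observations n S ξ) n / 2))) ∂(noiseLaw n)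
      ≤ ENNReal.ofReal (Real.exp (-(Real.log 2 / 2
          * ∑ i ∈ Finset.range (n - 1), weight n z₀ h (i + 2)))) := by
  set f : ℕ → (Fin n → ℝ) → ℝ≥0∞ := fun i ξ => ENNReal.ofReal
    (Real.exp (-(weight n z₀ h (i + 2) * entry (observations n S ξ) (i + 1) ^ 2 / 2))) with hf
  have hprod := lintegral_prod_adapted_le (gaussianReal 0 1) f
    (fun i => ENNReal.ofReal (Real.exp (-(Real.log 2 / 2 * weight n z₀ h (i + 2)))))
    ?_ ?_ ?_ (n - 1) (Nat.sub_le _ _)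
  · rw [← ENNReal.ofReal_prod_of_nonneg (fun i _ => (Real.exp_pos _).le), ← Real.exp_sum,
      Finset.sum_neg_distrib, ← Finset.mul_sum] at hprod
    refine le_trans (le_of_eq (lintegral_congr fun ξ => ?_)) hprod
    simp only [hf]
    rw [← ENNReal.ofReal_prod_of_nonneg (fun i _ => (Real.exp_pos _).le), ← Real.exp_sum,
      Finset.sum_neg_distrib, ← Finset.sum_div]
    congr 4
    rcases Nat.eq_zero_or_pos n with rfl | hn
    · simp [energy]
    · obtain ⟨m, rfl⟩ : ∃ m, n = m + 1 := ⟨n - 1, by omega⟩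
      rw [energy, sum_Icc_one_eq_sum_range, Finset.sum_range_succ']
      simp [entry]
  · intro i
    have h1 := (measurable_entry (n := n) (i + 1)).comp (measurable_observations n S)
    have h2 := ((h1.pow_const 2).const_mul (weight n z₀ h (i + 2))).div_const 2
    exact (Real.measurable_exp.comp h2.neg).ennreal_ofReal
  · intro i j hij ξ x
    simp only [hf]
    rw [entry_observations_update S ξ j x hij]
  · intro i ξ
    simp only [hf]
    rcases weight_eq_zero_or_one n z₀ h (i + 2) with hw | hw
    · simp [hw]
    · simp only [hw, one_mul, mul_one]
      refine le_trans (le_of_eq (lintegral_congr fun x => ?_)) (lintegral_exp_neg_sq_gaussianReal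
        (S ((((i : ℕ) + 1 : ℕ) : ℝ) / n) * entry (observations n S ξ) i))
      rw [entry_observations_succ S _ (by have := i.isLt; omega), entry_observations_update S ξ i x le_rfl,
        entry_of_le, Function.update_self, neg_div]

theorem measure_energy_lt_le (S : ℝ → ℝ) {h : ℝ} (hh : 0 < h) (hl : h < z₀) (hu : z₀ + h ≤ 1)
    (hn : 0 < n) :
    noiseLaw n {ξ | energy z₀ h (observations n S ξ) n < n * h}
      ≤ ENNReal.ofReal (Real.exp (1 - (n * h) / 8)) := by
  have hE := (measurable_energy (n := n) z₀ h n).comp (measurable_observations n S)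
  have h1 := measure_le_of_lintegral_exp_le (noiseLaw n)
    (fun ξ => -(energy z₀ h (observations n S ξ) n / 2)) (hE.div_const 2).neg
    (lintegral_exp_neg_energy_le z₀ h S) (-(n * h / 2))
  refine (measure_mono fun ξ hξ => ?_).trans (h1.trans (ENNReal.ofReal_le_ofReal
    (Real.exp_le_exp.2 ?_)))
  · have : energy z₀ h (observations n S ξ) n < n * h := hξ
    show -(n * h / 2) ≤ -(energy z₀ h (observations n S ξ) n / 2)
    linarith
  -- The exponent is at most `nh/2 - ln 2 · (nh - 1)`, and `1/2 + 1/8 < ln 2 < 1`.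
  · have h2 := two_mul_sub_two_le_sum_weight z₀ hh hl hu hn
    have h3 := Real.log_two_gt_d9
    have h4 := Real.log_two_lt_d9
    have h5 : 0 ≤ (n : ℝ) * h := by positivity
    nlinarith

end SequentialEstimator

/-! ### Rates, bandwidths and the grid -/

section Rates

variable {n : ℕ} {β β₁ β₂ : ℝ}

theorem rate_pos (hD : 1 ≤ dn n) (β : ℝ) : 0 < rate n β :=
  Real.rpow_pos_of_pos (by linarith) _

theorem bandwidth_eq (hD : 1 ≤ dn n) (β : ℝ) : bandwidth n β = dn n ^ (-(1 / (2 * β + 1))) := by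
  rw [bandwidth, one_div (dn n), Real.inv_rpow (by linarith), Real.rpow_neg (by linarith)]

theorem bandwidth_pos (hD : 1 ≤ dn n) (β : ℝ) : 0 < bandwidth n β := by
  rw [bandwidth_eq hD]
  exact Real.rpow_pos_of_pos (by linarith) _

theorem div_two_mul_add_one_le (h₁ : 0 ≤ β₁) (h : β₁ ≤ β₂) :
    β₁ / (2 * β₁ + 1) ≤ β₂ / (2 * β₂ + 1) := by
  rw [div_le_div_iff₀ (by linarith) (by linarith)]
  nlinarith

theorem rate_mono (hD : 1 ≤ dn n) (h₁ : 0 ≤ β₁) (h : β₁ ≤ β₂) : rate n β₁ ≤ rate n β₂ :=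
  Real.rpow_le_rpow_of_exponent_le hD (div_two_mul_add_one_le h₁ h)

theorem rate_le_dn (hD : 1 ≤ dn n) (hβ : 0 ≤ β) : rate n β ≤ dn n := by
  conv_rhs => rw [← Real.rpow_one (dn n)]
  refine Real.rpow_le_rpow_of_exponent_le hD ?_
  rw [div_le_one (by linarith)]
  linarith

/-- The exponent `β / (2β + 1)` is 1-Lipschitz on `β ≥ 0`. -/
theorem rate_le_exp_mul_rate (hD : 1 ≤ dn n) (h₁ : 0 ≤ β₁) (h : β₁ ≤ β₂)
    (hlog : (β₂ - β₁) * Real.log (dn n) ≤ 1) : rate n β₂ ≤ Real.exp 1 * rate n β₁ := by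
  have hpos : 0 < dn n := by linarith
  unfold rate
  rw [Real.rpow_def_of_pos hpos, Real.rpow_def_of_pos hpos, ← Real.exp_add]
  refine Real.exp_le_exp.2 ?_
  have hl := Real.log_nonneg hD
  have hdiff : β₂ / (2 * β₂ + 1) - β₁ / (2 * β₁ + 1) ≤ β₂ - β₁ := by
    rw [div_sub_div _ _ (by linarith) (by linarith), div_le_iff₀ (by nlinarith)]
    have h3 : 0 ≤ (β₂ - β₁) * (2 * β₂ + 2 * β₁ + 4 * β₁ * β₂) := by
      have : 0 ≤ β₁ * β₂ := mul_nonneg h₁ (h₁.trans h)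
      exact mul_nonneg (by linarith) (by linarith)
    nlinarith
  nlinarith [mul_le_mul_of_nonneg_right hdiff hl]

theorem mul_bandwidth_eq (hD : 1 ≤ dn n) (hlog : 1 ≤ Real.log n) (hβ : 0 ≤ β) :
    (n : ℝ) * bandwidth n β = Real.log n * rate n β ^ 2 := by
  have hpos : 0 < dn n := by linarith
  have hn : (n : ℝ) = Real.log n * dn n := by
    rw [dn, mul_div_cancel₀]
    linarith
  rw [hn, mul_assoc, bandwidth_eq hD, rate, ← Real.rpow_natCast, ← Real.rpow_mul hpos.le, ← hn]
  congr 1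
  nth_rewrite 1 [← Real.rpow_one (dn n)]
  rw [← Real.rpow_add hpos]
  congr 1
  have : 2 * β + 1 ≠ 0 := by linarith
  field_simp
  push_cast
  ring

/-- Bias control. Taking `β₂` to be the grid point after `β₁` shows that below `k₀` the bias already
meets the next, faster rate, which is why the thresholds can involve `N_{k+1}`. -/
theorem bandwidth_rpow_le (hD : 1 ≤ dn n) (h₁ : 0 ≤ β₁) (h : β₁ ≤ β₂) (h₂ : β₂ ≤ β) :
    bandwidth n β₁ ^ β ≤ 1 / rate n β₂ := by
  have hpos : 0 < dn n := by linarith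
  rw [bandwidth_eq hD, ← Real.rpow_mul hpos.le, one_div (rate n β₂), rate, ← Real.rpow_neg hpos.le]
  refine Real.rpow_le_rpow_of_exponent_le hD ?_
  have h3 : β₂ / (2 * β₂ + 1) ≤ β / (2 * β₁ + 1) := by
    rw [div_le_div_iff₀ (by linarith) (by linarith)]
    nlinarith [mul_nonneg (h₁.trans h) (sub_nonneg.2 h), mul_nonneg (sub_nonneg.2 h₂) (h₁.trans h)]
  have h4 : -(1 / (2 * β₁ + 1)) * β = -(β / (2 * β₁ + 1)) := by ring
  rw [h4]
  linarith

end Rates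

section Grid

variable {b B : ℝ} {n : ℕ}

theorem gridSize_pos (n : ℕ) : (0 : ℝ) < gridSize n := by
  unfold gridSize; positivity

theorem gridPoint_zero : gridPoint b B n 0 = b := by simp [gridPoint]

theorem gridPoint_gridSize : gridPoint b B n (gridSize n) = B := by
  rw [gridPoint, div_self (gridSize_pos n).ne']
  ring

theorem gridPoint_succ_sub (k : ℕ) :
    gridPoint b B n (k + 1) - gridPoint b B n k = (B - b) / gridSize n := by
  unfold gridPoint
  push_cast
  ring

theorem monotone_gridPoint (hbB : b ≤ B) : Monotone (gridPoint b B n) := by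
  refine monotone_nat_of_le_succ fun k => ?_
  have h := gridPoint_succ_sub (b := b) (B := B) (n := n) k
  have : 0 ≤ (B - b) / gridSize n := div_nonneg (by linarith) (gridSize_pos n).le
  linarith

theorem le_gridPoint (hbB : b ≤ B) (k : ℕ) : b ≤ gridPoint b B n k := by
  have := monotone_gridPoint (n := n) hbB (Nat.zero_le k)
  rwa [gridPoint_zero] at this

theorem gridPoint_mem_Icc (hbB : b ≤ B) {k : ℕ} (hk : k ≤ gridSize n) :
    gridPoint b B n k ∈ Icc b B := by
  refine ⟨le_gridPoint hbB k, ?_⟩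
  have := monotone_gridPoint (n := n) hbB hk
  rwa [gridPoint_gridSize] at this

theorem gridPoint_step_mul_log_le (hb : 0 ≤ b) (hB : B ≤ 1) (hD : 1 ≤ dn n) (k : ℕ) :
    (gridPoint b B n (k + 1) - gridPoint b B n k) * Real.log (dn n) ≤ 1 := by
  rw [gridPoint_succ_sub, div_mul_eq_mul_div, div_le_one (gridSize_pos n)]
  have h1 : Real.log (dn n) < gridSize n := by
    unfold gridSize
    push_cast
    exact Nat.lt_floor_add_one _
  have h2 := Real.log_nonneg hD
  nlinarith

theorem exists_gridPoint_le (hb : 0 ≤ b) (hB : B ≤ 1) (hD : 1 ≤ dn n) {β : ℝ}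
    (hβ : β ∈ Icc b B) : ∃ k ≤ gridSize n, gridPoint b B n k ≤ β ∧
      (β - gridPoint b B n k) * Real.log (dn n) ≤ 1 := by
  classical
  set k := Nat.findGreatest (fun k => gridPoint b B n k ≤ β) (gridSize n) with hk
  have hle : k ≤ gridSize n := Nat.findGreatest_le _
  have hspec : gridPoint b B n k ≤ β :=
    Nat.findGreatest_spec (P := fun k => gridPoint b B n k ≤ β) (Nat.zero_le _)
      (by rw [gridPoint_zero]; exact hβ.1)
  refine ⟨k, hle, hspec, ?_⟩
  have hl := Real.log_nonneg hD
  rcases hle.eq_or_lt with he | hlt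
  · rw [he, gridPoint_gridSize]
    nlinarith [mul_nonneg (sub_nonneg.2 hβ.2) hl]
  · have hgt : β < gridPoint b B n (k + 1) := by
      have := Nat.findGreatest_is_greatest (P := fun k => gridPoint b B n k ≤ β)
        (Nat.lt_succ_self k) hlt
      exact not_le.1 this
    refine le_trans ?_ (gridPoint_step_mul_log_le hb hB hD k)
    gcongr

theorem gridRate_pos (hD : 1 ≤ dn n) (k : ℕ) : 0 < gridRate b B n k := rate_pos hD _

theorem monotone_gridRate (hb : 0 ≤ b) (hbB : b ≤ B) (hD : 1 ≤ dn n) :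
    Monotone (gridRate b B n) := fun _ _ hkl =>
  rate_mono hD (hb.trans (le_gridPoint hbB _)) (monotone_gridPoint hbB hkl)

/-! ### The deterministic part of Lepskiĭ's procedure -/

variable {z₀ lam : ℝ}

theorem selectedIndex_le_gridSize (Y : Fin n → ℝ) : selectedIndex b B z₀ lam Y ≤ gridSize n := by
  unfold selectedIndex
  have := Nat.sInf_le (show gridSize n + 1 ∈
    ({j : ℕ | j ≤ gridSize n ∧ lam / gridRate b B n j ≤ omega b B z₀ lam j Y} ∪
      {gridSize n + 1}) from Or.inr rfl)
  omega

/-- Purely deterministic: by the triangle inequality two accurate estimators pass their mutual test,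
and an accepted index at or beyond `k₀` has been compared with `k₀`. -/
theorem abs_adaptiveEstimator_sub_le {Y : Fin n → ℝ} {s : ℝ} {k₀ : ℕ}
    (hN : ∀ k, 0 < gridRate b B n k) (hmono : Monotone (gridRate b B n)) (hlam : 0 < lam)
    (hk₀ : k₀ ≤ gridSize n)
    (h₁ : ∀ j ≤ k₀, |gridEstimator b B z₀ j Y - s| < lam / gridRate b B n j)
    (h₂ : ∀ k < k₀, |gridEstimator b B z₀ k Y - s| ≤ lam / gridRate b B n (k + 1)) :
    |adaptiveEstimator b B z₀ lam n Y - s| ≤ 3 * lam / gridRate b B n k₀ := by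
  set A := {j : ℕ | j ≤ gridSize n ∧ lam / gridRate b B n j ≤ omega b B z₀ lam j Y} ∪
      {gridSize n + 1} with hA
  set T := fun k => gridEstimator b B z₀ k Y with hT
  have hpA : sInf A ∈ A := Nat.sInf_mem ⟨gridSize n + 1, Or.inr rfl⟩
  set p := sInf A with hp
  have hpos : ∀ k, 0 < lam / gridRate b B n k := fun k => div_pos hlam (hN k)
  have hpm : p ≤ gridSize n + 1 := Nat.sInf_le (Or.inr rfl)
  have hpk : k₀ < p := by
    by_contra hc
    rw [not_lt] at hc
    rcases hpA with ⟨-, hω⟩ | hω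
    · rw [omega, Finset.le_sup'_iff] at hω
      obtain ⟨k, hk, hω⟩ := hω
      -- The diagonal term of the maximum is negative, so it never causes a rejection; strictness in
      -- `h₁` settles the others.
      rcases (Nat.lt_succ_iff.1 (Finset.mem_range.1 hk)).eq_or_lt with rfl | hlt
      · rw [sub_self, abs_zero] at hω
        linarith [hpos p, hpos (p + 1)]
      · have h3 := h₁ p hc
        have h4 := h₂ k (by omega)
        have h5 := abs_sub_le (T p) s (T k)
        rw [abs_sub_comm s] at h5
        simp only [hT] at h5
        linarith
    · have : p = gridSize n + 1 := hω
      omega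
  have hsel : selectedIndex b B z₀ lam Y = p - 1 := rfl
  obtain ⟨q, hq⟩ : ∃ q, p = q + 1 := ⟨p - 1, by omega⟩
  -- The selected index lies just before the first rejected one, hence was accepted; its test
  -- against `k₀ ≤ q` is what is used.
  have hqA : q ∉ A := Nat.notMem_of_lt_sInf (by omega)
  have hωq : omega b B z₀ lam q Y < lam / gridRate b B n q := by
    by_contra hc
    exact hqA (Or.inl ⟨by omega, not_lt.1 hc⟩)
  rw [omega, Finset.sup'_lt_iff] at hωq
  have h3 := hωq k₀ (Finset.mem_range.2 (by omega))
  have h4 := h₁ k₀ le_rfl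
  have h5 := abs_sub_le (T q) (T k₀) s
  simp only [hT] at h5
  have h6 : lam / gridRate b B n q ≤ lam / gridRate b B n k₀ := by
    have := hN k₀
    have := hmono (show k₀ ≤ q by omega)
    gcongr
  have h7 : lam / gridRate b B n (k₀ + 1) ≤ lam / gridRate b B n k₀ := by
    have := hN k₀
    have := hmono (Nat.le_succ k₀)
    gcongr
  have h8 : adaptiveEstimator b B z₀ lam n Y = gridEstimator b B z₀ q Y := by
    rw [adaptiveEstimator, hsel, hq, Nat.add_sub_cancel]
  rw [h8]
  have h9 : 3 * lam / gridRate b B n k₀ = 3 * (lam / gridRate b B n k₀) := by ring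
  rw [h9]
  linarith

end Grid

section GridError

variable {b B z₀ K ε β : ℝ} {n : ℕ} {S : ℝ → ℝ}

/-- The stochastic part of the estimator with the `k`-th bandwidth of the grid. -/
def gridNoise (b B z₀ : ℝ) {n : ℕ} (S : ℝ → ℝ) (k : ℕ) (ξ : Fin n → ℝ) : ℝ :=
  noiseTerm z₀ ((n : ℝ) * gridBandwidth b B n k) (gridBandwidth b B n k) S ξ

/-- The event that the energy in the `k`-th window stays below the prescribed level. -/
def lowEnergy (b B z₀ : ℝ) (n : ℕ) (S : ℝ → ℝ) (k : ℕ) : Set (Fin n → ℝ) :=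
  {ξ | energy z₀ (gridBandwidth b B n k) (observations n S ξ) n < n * gridBandwidth b B n k}

/-- The event that some window of the grid has low energy or a large stochastic part. -/
def badEvent (b B z₀ x : ℝ) (n : ℕ) (S : ℝ → ℝ) : Set (Fin n → ℝ) :=
  ⋃ k ∈ Finset.range (gridSize n + 1),
    (lowEnergy b B z₀ n S k ∪ {ξ | x / gridRate b B n k ≤ |gridNoise b B z₀ S k ξ|})

theorem node_mem_Ioc {i : ℕ} (hi : i < n) : ((i + 1 : ℕ) : ℝ) / n ∈ Ioc (0 : ℝ) 1 := by
  have hn : (0 : ℝ) < n := Nat.cast_pos.2 (by omega)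
  refine ⟨by positivity, ?_⟩
  rw [div_le_one hn]
  exact_mod_cast hi

theorem abs_gridEstimator_sub_le_of_holder (hK : 0 ≤ K) (hβ : 0 ≤ β)
    (hn : 0 < n) (hD : 1 ≤ dn n) (hS : S ∈ holderClass β z₀ K ε) {k : ℕ} {ξ : Fin n → ℝ}
    (hξ : ξ ∉ lowEnergy b B z₀ n S k) :
    |gridEstimator b B z₀ k (observations n S ξ) - S z₀|
      ≤ K * gridBandwidth b B n k ^ β + |gridNoise b B z₀ S k ξ| := by
  have hh : 0 < gridBandwidth b B n k := bandwidth_pos hD _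
  have hH : 0 < (n : ℝ) * gridBandwidth b B n k := mul_pos (Nat.cast_pos.2 hn) hh
  have h := abs_seqKernelEstimator_sub_sub_noiseTerm_le z₀ _ (S := S) (ξ := ξ) hh hH
    (not_lt.1 hξ) (D := K * gridBandwidth b B n k ^ β) fun i hi hw =>
      (hS.2 _ (node_mem_Ioc hi)).trans (by gcongr)
  have h2 := abs_add_le (gridEstimator b B z₀ k (observations n S ξ) - S z₀
    - gridNoise b B z₀ S k ξ) (gridNoise b B z₀ S k ξ)
  rw [sub_add_cancel] at h2
  exact h2.trans (add_le_add_left h _)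

/-- Crude control valid on every path, for use on the bad event: stability bounds the bias by `2`,
and the default value `0` errs by at most `1`. -/
theorem abs_gridEstimator_sub_le_two_add (hz₀ : z₀ ∈ Ioo (0 : ℝ) 1) (hε : 0 < ε)
    (hn : 0 < n) (hD : 1 ≤ dn n) (hS : S ∈ stabilitySet ε) (k : ℕ) (ξ : Fin n → ℝ) :
    |gridEstimator b B z₀ k (observations n S ξ) - S z₀| ≤ 2 + |gridNoise b B z₀ S k ξ| := by
  have hh : 0 < gridBandwidth b B n k := bandwidth_pos hD _
  have hH : 0 < (n : ℝ) * gridBandwidth b B n k := mul_pos (Nat.cast_pos.2 hn) hh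
  have hz := hS.2 z₀ ⟨hz₀.1, hz₀.2.le⟩
  have h0 := abs_nonneg (gridNoise b B z₀ S k ξ)
  by_cases hξ : ξ ∈ lowEnergy b B z₀ n S k
  · rw [gridEstimator, seqKernelEstimator_of_lt _ _ _ _ hξ, zero_sub, abs_neg]
    linarith
  · have h := abs_seqKernelEstimator_sub_sub_noiseTerm_le z₀ _ (S := S) (ξ := ξ) hh hH
      (not_lt.1 hξ) (D := 2) fun i hi _ => by
        have h1 := hS.2 _ (node_mem_Ioc hi)
        have h2 := abs_sub (S (((i + 1 : ℕ) : ℝ) / n)) (S z₀)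
        linarith
    have h2 := abs_add_le (gridEstimator b B z₀ k (observations n S ξ) - S z₀
      - gridNoise b B z₀ S k ξ) (gridNoise b B z₀ S k ξ)
    rw [sub_add_cancel] at h2
    exact h2.trans (add_le_add_left h _)

theorem abs_adaptiveEstimator_sub_le_of_notMem_badEvent {x lam : ℝ} (hb : 0 < b) (hbB : b ≤ B)
    (hB : B ≤ 1) (hK : 0 < K) (hx : 0 ≤ x)
    (hlam : K + Real.exp 1 * x < lam) (hn : 0 < n) (hD : 1 ≤ dn n) (hβ : β ∈ Icc b B)
    (hS : S ∈ holderClass β z₀ K ε) {ξ : Fin n → ℝ} (hξ : ξ ∉ badEvent b B z₀ x n S) :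
    |adaptiveEstimator b B z₀ lam n (observations n S ξ) - S z₀|
      ≤ 3 * Real.exp 1 * lam / rate n β := by
  obtain ⟨k₀, hk₀, hle, hlog⟩ := exists_gridPoint_le hb.le hB hD hβ
  have he : 1 ≤ Real.exp 1 := Real.one_le_exp zero_le_one
  have hlam0 : 0 < lam := by nlinarith
  have hN := gridRate_pos (b := b) (B := B) hD
  have hgb : ∀ k, 0 ≤ gridPoint b B n k := fun k => hb.le.trans (le_gridPoint hbB k)
  have hβ0 : 0 ≤ β := hb.le.trans hβ.1
  have hgood : ∀ k ≤ k₀, ξ ∉ lowEnergy b B z₀ n S k ∧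
      |gridNoise b B z₀ S k ξ| < x / gridRate b B n k := by
    intro k hk
    simp only [badEvent, mem_iUnion, not_exists] at hξ
    have h := hξ k (Finset.mem_range.2 (by omega))
    exact ⟨fun hc => h (Or.inl hc), not_le.1 fun hc => h (Or.inr hc)⟩
  have herr := fun k hk => abs_gridEstimator_sub_le_of_holder hK.le hβ0 hn hD hS (hgood k hk).1
  have h := abs_adaptiveEstimator_sub_le (z₀ := z₀) (Y := observations n S ξ) (s := S z₀) hN
    (monotone_gridRate hb.le hbB hD) hlam0 hk₀ ?_ ?_
  · refine h.trans ?_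
    have hr : rate n β ≤ Real.exp 1 * gridRate b B n k₀ :=
      rate_le_exp_mul_rate hD (hgb k₀) hle hlog
    rw [div_le_div_iff₀ (hN k₀) (rate_pos hD β)]
    nlinarith
  · intro j hj
    have h1 : gridBandwidth b B n j ^ β ≤ 1 / gridRate b B n j :=
      bandwidth_rpow_le hD (hgb j) le_rfl ((monotone_gridPoint hbB hj).trans hle)
    have h2 := herr j hj
    have h3 := (hgood j hj).2
    calc _ < K * (1 / gridRate b B n j) + x / gridRate b B n j := by nlinarith
      _ = (K + x) / gridRate b B n j := by ring
      _ ≤ lam / gridRate b B n j := by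
        have := hN j
        gcongr
        nlinarith
  · intro k hk
    have h1 : gridBandwidth b B n k ^ β ≤ 1 / gridRate b B n (k + 1) :=
      bandwidth_rpow_le hD (hgb k) (monotone_gridPoint hbB (Nat.le_succ k))
        ((monotone_gridPoint hbB hk).trans hle)
    have h2 := herr k hk.le
    have h3 := (hgood k hk.le).2
    have h4 : gridRate b B n (k + 1) ≤ Real.exp 1 * gridRate b B n k :=
      rate_le_exp_mul_rate hD (hgb k) (monotone_gridPoint hbB (Nat.le_succ k))
        (gridPoint_step_mul_log_le hb.le hB hD k)
    -- Passing from `N_k` to `N_{k+1}` costs the factor `e`, the source of `e` in the condition on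
    -- `λ`.
    have h5 : x / gridRate b B n k ≤ Real.exp 1 * x / gridRate b B n (k + 1) := by
      rw [div_le_div_iff₀ (hN k) (hN (k + 1))]
      nlinarith
    calc _ ≤ K * (1 / gridRate b B n (k + 1)) + Real.exp 1 * x / gridRate b B n (k + 1) := by
          nlinarith
      _ = (K + Real.exp 1 * x) / gridRate b B n (k + 1) := by ring
      _ ≤ lam / gridRate b B n (k + 1) := by
        have := hN (k + 1)
        gcongr

/-! ### Probability of the bad event -/

theorem measurable_gridNoise (k : ℕ) :
    Measurable fun ξ : Fin n → ℝ => gridNoise b B z₀ S k ξ :=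
  measurable_noiseTerm _ _ _ S

theorem measurableSet_badEvent {x : ℝ} : MeasurableSet (badEvent b B z₀ x n S) := by
  refine MeasurableSet.iUnion fun k => MeasurableSet.iUnion fun _ => ?_
  exact (measurableSet_lt ((measurable_energy z₀ _ n).comp (measurable_observations n S))
    measurable_const).union (measurableSet_le measurable_const (measurable_gridNoise k).abs)

theorem exp_neg_two_mul_log (hlog : 1 ≤ Real.log n) :
    Real.exp (-(2 * Real.log n)) = 1 / (n : ℝ) ^ 2 := by
  have hn : (0 : ℝ) < n := by
    rcases Nat.eq_zero_or_pos n with rfl | h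
    · norm_num at hlog
    · exact Nat.cast_pos.2 h
  rw [Real.exp_neg, ← Real.log_rpow hn, Real.exp_log (by positivity), one_div]
  norm_num

theorem measure_badEvent_le {x : ℝ} (hb : 0 < b) (hbB : b ≤ B) (hlog : 1 ≤ Real.log n)
    (hD : 1 ≤ dn n) (hx : 2 ≤ x) (hN : 5 ≤ rate n b)
    (hh : ∀ β ∈ Icc b B, bandwidth n β < z₀ ∧ z₀ + bandwidth n β ≤ 1) :
    noiseLaw n (badEvent b B z₀ x n S)
      ≤ ENNReal.ofReal (((gridSize n + 1 : ℕ) : ℝ) * (3 * (1 / (n : ℝ) ^ 2))) := by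
  have hn : 0 < n := by
    rcases Nat.eq_zero_or_pos n with rfl | h
    · norm_num at hlog
    · exact h
  have hn' : (0 : ℝ) < n := Nat.cast_pos.2 hn
  have hk : ∀ k ∈ Finset.range (gridSize n + 1), noiseLaw n
      (lowEnergy b B z₀ n S k ∪ {ξ | x / gridRate b B n k ≤ |gridNoise b B z₀ S k ξ|})
        ≤ ENNReal.ofReal (3 * (1 / (n : ℝ) ^ 2)) := by
    intro k hk
    have hmem := gridPoint_mem_Icc (n := n) hbB (Nat.lt_succ_iff.1 (Finset.mem_range.1 hk))
    have hh0 : 0 < gridBandwidth b B n k := bandwidth_pos hD _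
    have hH : 0 < (n : ℝ) * gridBandwidth b B n k := mul_pos hn' hh0
    have hHeq : (n : ℝ) * gridBandwidth b B n k = Real.log n * gridRate b B n k ^ 2 :=
      mul_bandwidth_eq hD hlog (hb.le.trans hmem.1)
    have hNk : 0 < gridRate b B n k := gridRate_pos hD k
    have hN5 : 5 ≤ gridRate b B n k := hN.trans (rate_mono hD hb.le hmem.1)
    have h1 : noiseLaw n (lowEnergy b B z₀ n S k) ≤ ENNReal.ofReal (1 / (n : ℝ) ^ 2) := by
      refine (measure_energy_lt_le z₀ S hh0 (hh _ hmem).1 (hh _ hmem).2 hn).trans ?_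
      rw [← exp_neg_two_mul_log hlog]
      refine ENNReal.ofReal_le_ofReal (Real.exp_le_exp.2 ?_)
      rw [hHeq]
      -- `N_k ≥ 5` suffices because `1 - (25/8) ln n ≤ -2 ln n` once `ln n ≥ 1`.
      have : 25 * Real.log n ≤ Real.log n * gridRate b B n k ^ 2 := by
        have : 25 ≤ gridRate b B n k ^ 2 := by nlinarith
        nlinarith
      linarith
    have h2 : noiseLaw n {ξ | x / gridRate b B n k ≤ |gridNoise b B z₀ S k ξ|}
        ≤ 2 * ENNReal.ofReal (1 / (n : ℝ) ^ 2) := by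
      refine (measure_abs_ge_le_of_lintegral_exp_le (noiseLaw n) _ (measurable_gridNoise k)
        (v := 1 / ((n : ℝ) * gridBandwidth b B n k)) (by positivity)
        (lintegral_exp_noiseTerm_le z₀ _ _ S hH) (by positivity)).trans ?_
      rw [← exp_neg_two_mul_log hlog]
      gcongr
      rw [hHeq]
      have : (x / gridRate b B n k) ^ 2 / (2 * (1 / (Real.log n * gridRate b B n k ^ 2)))
          = x ^ 2 / 2 * Real.log n := by
        have : Real.log n ≠ 0 := by linarith
        field_simp
      rw [this]
      -- `x ≥ 2` makes each Gaussian tail at most `n^(-2)`.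
      have : 2 ≤ x ^ 2 / 2 := by nlinarith
      nlinarith
    calc _ ≤ _ := measure_union_le _ _
      _ ≤ ENNReal.ofReal (1 / (n : ℝ) ^ 2) + 2 * ENNReal.ofReal (1 / (n : ℝ) ^ 2) :=
        add_le_add h1 h2
      _ = _ := by
        rw [ENNReal.ofReal_mul (by norm_num : (0:ℝ) ≤ 3)]
        norm_num
        ring
  calc _ ≤ _ := measure_biUnion_finset_le _ _
    _ ≤ ∑ _k ∈ Finset.range (gridSize n + 1), ENNReal.ofReal (3 * (1 / (n : ℝ) ^ 2)) :=
      Finset.sum_le_sum hk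
    _ = _ := by
      rw [Finset.sum_const, Finset.card_range, nsmul_eq_mul,
        ENNReal.ofReal_mul (Nat.cast_nonneg _), ENNReal.ofReal_natCast]

/-! ### The risk bound for a fixed sample size -/

theorem lintegral_abs_adaptiveEstimator_sub_le {x lam : ℝ} (hb : 0 < b) (hbB : b ≤ B)
    (hB : B ≤ 1) (hz₀ : z₀ ∈ Ioo (0 : ℝ) 1) (hK : 0 < K) (hε : 0 < ε) (hx : 2 ≤ x)
    (hlam : K + Real.exp 1 * x < lam) (hlog : 1 ≤ Real.log n) (hD : 1 ≤ dn n)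
    (hN : 5 ≤ rate n b)
    (hh : ∀ β ∈ Icc b B, bandwidth n β < z₀ ∧ z₀ + bandwidth n β ≤ 1) (hβ : β ∈ Icc b B)
    (hS : S ∈ holderClass β z₀ K ε) :
    ∫⁻ Y, ENNReal.ofReal |adaptiveEstimator b B z₀ lam n Y - S z₀| ∂(observationLaw n S)
      ≤ ENNReal.ofReal (3 * Real.exp 1 * lam / rate n β
          + 13 * ((gridSize n + 1 : ℕ) : ℝ) / n) := by
  have hn : 0 < n := by
    rcases Nat.eq_zero_or_pos n with rfl | h
    · norm_num at hlog
    · exact h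
  have hn2 : (2 : ℝ) ≤ n := by
    have : (n : ℝ) ≠ 1 := by
      intro hc
      rw [hc, Real.log_one] at hlog
      linarith
    have h1 : n ≠ 1 := by exact_mod_cast this
    exact_mod_cast (by omega : 2 ≤ n)
  have hn' : (0 : ℝ) < n := by linarith
  set G := badEvent b B z₀ x n S with hG
  set u := fun k (ξ : Fin n → ℝ) => gridNoise b B z₀ S k ξ with hu
  have hGm : MeasurableSet G := measurableSet_badEvent
  have hlam0 : 0 < lam := by
    have := Real.exp_pos 1
    nlinarith
  set c := 3 * Real.exp 1 * lam / rate n β with hc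
  have hc0 : 0 ≤ c := by
    have := rate_pos hD β
    positivity
  have hm := measurable_adaptiveEstimator b B z₀ lam n
  have hpt : ∀ ξ, ENNReal.ofReal
      |adaptiveEstimator b B z₀ lam n (observations n S ξ) - S z₀|
        ≤ ENNReal.ofReal c + (G.indicator (fun _ => ENNReal.ofReal (2 + n)) ξ
          + ∑ k ∈ Finset.range (gridSize n + 1),
            ENNReal.ofReal (1 / n) * ENNReal.ofReal (u k ξ ^ 2)) := by
    intro ξ
    by_cases hξ : ξ ∈ G
    · rw [Set.indicator_of_mem hξ]
      set k := selectedIndex b B z₀ lam (observations n S ξ) with hk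
      have hkm : k ∈ Finset.range (gridSize n + 1) :=
        Finset.mem_range.2 (Nat.lt_succ_of_le (selectedIndex_le_gridSize _))
      have h1 := abs_gridEstimator_sub_le_two_add (b := b) (B := B) hz₀ hε hn hD hS.1 k ξ
      -- The selected index is random, so the noise is split at scale `n`: the constant is paid with
      -- the small probability of `G`, and the squares are summed over the whole grid at cost `1/n`
      -- each.
      have h2 : |u k ξ| ≤ n + 1 / n * u k ξ ^ 2 := by
        have h3 : |u k ξ| * n ≤ (n + 1 / n * u k ξ ^ 2) * n := by
          have : (n + 1 / n * u k ξ ^ 2) * n = (n : ℝ) ^ 2 + |u k ξ| ^ 2 := by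
            rw [sq_abs]
            field_simp
          rw [this]
          nlinarith [sq_nonneg (|u k ξ| - n), abs_nonneg (u k ξ)]
        exact le_of_mul_le_mul_right h3 hn'
      refine le_trans ?_ le_add_self
      calc ENNReal.ofReal |adaptiveEstimator b B z₀ lam n (observations n S ξ) - S z₀|
          ≤ ENNReal.ofReal ((2 + n) + 1 / n * u k ξ ^ 2) := by
            refine ENNReal.ofReal_le_ofReal (h1.trans ?_)
            simp only [hu] at h2 ⊢
            linarith
        _ = ENNReal.ofReal (2 + n) + ENNReal.ofReal (1 / n) * ENNReal.ofReal (u k ξ ^ 2) := by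
            rw [ENNReal.ofReal_add (by positivity) (by positivity),
              ENNReal.ofReal_mul (by positivity)]
        _ ≤ _ := by
            gcongr
            exact Finset.single_le_sum
              (f := fun k => ENNReal.ofReal (1 / n) * ENNReal.ofReal (u k ξ ^ 2))
              (fun _ _ => zero_le) hkm
    · refine le_trans (ENNReal.ofReal_le_ofReal ?_) le_self_add
      exact abs_adaptiveEstimator_sub_le_of_notMem_badEvent hb hbB hB hK (by linarith) hlam
        hn hD hβ hS hξ
  have hsq : ∀ k ∈ Finset.range (gridSize n + 1),
      ∫⁻ ξ, ENNReal.ofReal (u k ξ ^ 2) ∂(noiseLaw n) ≤ ENNReal.ofReal 4 := by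
    intro k hk
    have hmem := gridPoint_mem_Icc (n := n) hbB (Nat.lt_succ_iff.1 (Finset.mem_range.1 hk))
    have hHeq : (n : ℝ) * gridBandwidth b B n k = Real.log n * gridRate b B n k ^ 2 :=
      mul_bandwidth_eq hD hlog (hb.le.trans hmem.1)
    have hN5 : 5 ≤ gridRate b B n k := hN.trans (rate_mono hD hb.le hmem.1)
    have hH : 1 ≤ (n : ℝ) * gridBandwidth b B n k := by
      rw [hHeq]
      have : 1 ≤ gridRate b B n k ^ 2 := by nlinarith
      nlinarith
    exact lintegral_sq_le_of_lintegral_exp_le (noiseLaw n) _ (measurable_gridNoise k)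
      (v := 1 / ((n : ℝ) * gridBandwidth b B n k)) (by rw [div_le_one (by linarith)]; exact hH)
      (lintegral_exp_noiseTerm_le z₀ _ _ S (by linarith))
  have hum : ∀ k, Measurable fun ξ => ENNReal.ofReal (u k ξ ^ 2) := fun k =>
    ((measurable_gridNoise k).pow_const 2).ennreal_ofReal
  rw [observationLaw, lintegral_map ((hm.sub_const _).abs.ennreal_ofReal)
    (measurable_observations n S)]
  calc _ ≤ _ := lintegral_mono hpt
    _ = ENNReal.ofReal c + (ENNReal.ofReal (2 + n) * noiseLaw n G
          + ∑ k ∈ Finset.range (gridSize n + 1),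
            ENNReal.ofReal (1 / n) * ∫⁻ ξ, ENNReal.ofReal (u k ξ ^ 2) ∂(noiseLaw n)) := by
        rw [lintegral_add_left measurable_const, lintegral_const, measure_univ, mul_one,
          lintegral_add_left (measurable_const.indicator hGm), lintegral_indicator_const hGm,
          lintegral_finsetSum _ fun k _ => (hum k).const_mul _]
        simp only [lintegral_const_mul _ (hum _)]
    _ ≤ ENNReal.ofReal c + (ENNReal.ofReal (2 + n)
          * ENNReal.ofReal (((gridSize n + 1 : ℕ) : ℝ) * (3 * (1 / (n : ℝ) ^ 2)))
          + ∑ _k ∈ Finset.range (gridSize n + 1), ENNReal.ofReal (1 / n) * ENNReal.ofReal 4) := by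
        gcongr with k hk
        · exact measure_badEvent_le hb hbB hlog hD hx hN hh
        · exact hsq k hk
    _ = ENNReal.ofReal (c + ((2 + n) * (((gridSize n + 1 : ℕ) : ℝ) * (3 * (1 / (n : ℝ) ^ 2)))
          + ((gridSize n + 1 : ℕ) : ℝ) * (1 / n * 4))) := by
        rw [Finset.sum_const, Finset.card_range, nsmul_eq_mul, ← ENNReal.ofReal_natCast,
          ← ENNReal.ofReal_mul (by positivity), ← ENNReal.ofReal_mul (by positivity),
          ← ENNReal.ofReal_mul (by positivity), ← ENNReal.ofReal_add (by positivity) (by positivity),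
          ← ENNReal.ofReal_add hc0 (by positivity)]
    _ ≤ _ := by
        refine ENNReal.ofReal_le_ofReal (add_le_add_right ?_ _)
        set M := ((gridSize n + 1 : ℕ) : ℝ) with hM
        have hM0 : 0 ≤ M := Nat.cast_nonneg _
        have h1 : (2 + (n : ℝ)) * (M * (3 * (1 / (n : ℝ) ^ 2))) ≤ (n + n) * (M * (3 * (1 / (n : ℝ) ^ 2))) := by
          gcongr
        have h2 : ((n : ℝ) + n) * (M * (3 * (1 / (n : ℝ) ^ 2))) = 6 * M / n := by
          field_simp
          ring
        have h3 : M * (1 / n * 4) = 4 * M / n := by ring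
        have h4 : 10 * M / n ≤ 13 * M / n := by gcongr; norm_num
        have h5 : 6 * M / n + 4 * M / n = 10 * M / n := by ring
        linarith

theorem risk_adaptiveEstimator_le {x lam : ℝ} (hb : 0 < b) (hbB : b ≤ B)
    (hB : B ≤ 1) (hz₀ : z₀ ∈ Ioo (0 : ℝ) 1) (hK : 0 < K) (hε : 0 < ε) (hx : 2 ≤ x)
    (hlam : K + Real.exp 1 * x < lam) (hlog : 1 ≤ Real.log n) (hD : 1 ≤ dn n)
    (hN : 5 ≤ rate n b)
    (hh : ∀ β ∈ Icc b B, bandwidth n β < z₀ ∧ z₀ + bandwidth n β ≤ 1) :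
    risk b B z₀ K ε n (adaptiveEstimator b B z₀ lam n)
      ≤ ENNReal.ofReal (3 * Real.exp 1 * lam + 39) := by
  refine iSup₂_le fun β hβ => iSup₂_le fun S hS => ?_
  have hr := rate_pos hD β
  have hβ0 : 0 ≤ β := hb.le.trans hβ.1
  refine (mul_le_mul_right (lintegral_abs_adaptiveEstimator_sub_le hb hbB hB hz₀ hK hε hx hlam
    hlog hD hN hh hβ hS) _).trans ?_
  rw [← ENNReal.ofReal_mul hr.le]
  refine ENNReal.ofReal_le_ofReal ?_
  have hl0 : 0 < Real.log n := by linarith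
  have hn' : (0 : ℝ) < n := by
    rcases Nat.eq_zero_or_pos n with rfl | h
    · norm_num at hlog
    · exact Nat.cast_pos.2 h
  have hrate : rate n β ≤ n / Real.log n := rate_le_dn hD hβ0
  have hdn : dn n ≤ n := by
    rw [dn, div_le_iff₀ hl0]
    nlinarith
  -- `m + 1 ≤ ln d_n + 2`, and `1 ≤ ln n` absorbs the constant. With the factor `13` this yields
  -- `39`.
  have hgrid : ((gridSize n + 1 : ℕ) : ℝ) ≤ 3 * Real.log n := by
    have h1 : (⌊Real.log (dn n)⌋₊ : ℝ) ≤ Real.log (dn n) := Nat.floor_le (Real.log_nonneg hD)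
    have h2 : Real.log (dn n) ≤ Real.log n := Real.log_le_log (by linarith) hdn
    unfold gridSize
    push_cast
    linarith
  have h1 : rate n β * (3 * Real.exp 1 * lam / rate n β) = 3 * Real.exp 1 * lam := by
    field_simp
  have h2 : rate n β * (13 * ((gridSize n + 1 : ℕ) : ℝ) / n) ≤ 39 := by
    calc rate n β * (13 * ((gridSize n + 1 : ℕ) : ℝ) / n)
        ≤ (n / Real.log n) * (13 * (3 * Real.log n) / n) := by gcongr
      _ = 39 := by field_simp; norm_num
  rw [mul_add, h1]
  linarith

end GridError

/-! ### Asymptotics of the rates -/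

theorem tendsto_dn_atTop : Tendsto dn atTop atTop := by
  have h : Tendsto (fun x : ℝ => x / Real.log x) atTop atTop := by
    have h0 : Tendsto (fun x : ℝ => Real.log x / x) atTop (nhdsWithin 0 (Ioi 0)) := by
      refine tendsto_nhdsWithin_iff.2 ⟨Real.isLittleO_log_id_atTop.tendsto_div_nhds_zero, ?_⟩
      filter_upwards [eventually_gt_atTop 1] with x hx
      exact div_pos (Real.log_pos hx) (by linarith)
    refine h0.inv_tendsto_nhdsGT_zero.congr fun x => ?_
    simp [inv_div]
  exact h.comp tendsto_natCast_atTop_atTop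

theorem eventually_bandwidth_lt {b B δ : ℝ} (hb : 0 < b) (hB : B ≤ 1) (hδ : 0 < δ) :
    ∀ᶠ n : ℕ in atTop, ∀ β ∈ Icc b B, bandwidth n β < δ := by
  -- For `β ≤ 1` the exponent `1 / (2β + 1)` is at least `1/3`, which makes the decay uniform in
  -- `β`.
  have h := (tendsto_rpow_neg_atTop (show (0 : ℝ) < 1 / 3 by norm_num)).comp tendsto_dn_atTop
  filter_upwards [h.eventually (gt_mem_nhds hδ), tendsto_dn_atTop.eventually_ge_atTop 1]
    with n hn hD β hβ
  refine lt_of_le_of_lt ?_ hn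
  rw [bandwidth_eq hD]
  refine Real.rpow_le_rpow_of_exponent_le hD (neg_le_neg ?_)
  exact one_div_le_one_div_of_le (by linarith [hβ.1]) (by linarith [hβ.2])

theorem eventually_le_rate {b : ℝ} (hb : 0 < b) (C : ℝ) : ∀ᶠ n : ℕ in atTop, C ≤ rate n b :=
  ((tendsto_rpow_atTop (by positivity : 0 < b / (2 * b + 1))).comp
    tendsto_dn_atTop).eventually_ge_atTop C

end NonparamAR

end

theorem theorem2 (b B z₀ K ε lam : ℝ)
    (hb : 0 < b) (hbB : b ≤ B) (hB : B ≤ 1)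
    (hz₀ : z₀ ∈ Set.Ioo (0 : ℝ) 1) (hK : 0 < K) (hε₀ : 0 < ε) (hε₁ : ε < 1)
    (hlam : K + Real.exp 1 * Real.sqrt (4 + 4 / (2 * b + 1)) < lam) :
    (∀ n : ℕ, Measurable (NonparamAR.adaptiveEstimator b B z₀ lam n)) ∧
    Filter.limsup
        (fun n : ℕ => NonparamAR.risk b B z₀ K ε n (NonparamAR.adaptiveEstimator b B z₀ lam n))
        Filter.atTop < ⊤ := by
  refine ⟨NonparamAR.measurable_adaptiveEstimator b B z₀ lam, ?_⟩
  -- The noise level `x` of the bad event is this square root; being at least `2` is what the tail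
  -- bounds need.
  have hx : 2 ≤ Real.sqrt (4 + 4 / (2 * b + 1)) := by
    refine Real.le_sqrt_of_sq_le ?_
    have : 0 < 4 / (2 * b + 1) := by positivity
    linarith
  have hlog : Tendsto (fun n : ℕ => Real.log n) atTop atTop :=
    Real.tendsto_log_atTop.comp tendsto_natCast_atTop_atTop
  refine lt_of_le_of_lt (Filter.limsup_le_of_le (by isBoundedDefault) ?_)
    (ENNReal.ofReal_lt_top (r := 3 * Real.exp 1 * lam + 39))
  filter_upwards [hlog.eventually_ge_atTop 1, NonparamAR.tendsto_dn_atTop.eventually_ge_atTop 1,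
    NonparamAR.eventually_le_rate hb 5, NonparamAR.eventually_bandwidth_lt (B := B) hb hB hz₀.1,
    NonparamAR.eventually_bandwidth_lt (B := B) hb hB (sub_pos.2 hz₀.2)] with n h1 h2 h3 h4 h5
  exact NonparamAR.risk_adaptiveEstimator_le hb hbB hB hz₀ hK hε₀ hx hlam h1 h2 h3 fun β hβ =>
    ⟨h4 β hβ, by linarith [h5 β hβ]⟩
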